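/- Let $d\ge 1$ be an integer and $\alpha\in(0,2)$. Let $(-\Delta)^{a/2}$ be the Fourier multiplier with symbol $|\xi|^{a}$ (for the Fourier transform $\hat g(\xi)=\int_{\mathbb R^d} e^{-iv\cdot\xi}g(v)\,dv$ and its extension to $L^2(\mathbb R^d)$), and let $$\mu_\alpha = Z_{d,\alpha}^{-1}\,\mathcal F^{-1}\big(e^{-|\xi|^\alpha/\alpha}\big),\qquad \int_{\mathbb R^d}\mu_\alpha=1 .$$ Let $L_\alpha f=\nabla_v\cdot(vf)-(-\Delta_v)^{\alpha/2}f$ be the Lévy–Fokker–Planck operator, with domain $$D(L_\alpha)=\{f\in L^2(\mu_\alpha^{-1})\,:\, L_\alpha f\in L^2(\mu_\alpha^{-1})\},$$ where $L_\alpha f$ is taken in the sense of distributions and $L^2(\mu_\alpha^{-1})$ is the space of measurable $f:\mathbb R^d\to\mathbb R$ with $\int f^2\mu_\alpha^{-1}<\infty$. Put $\Pi f=\big(\int_{\mathbb R^d} f(w)\,dw\big)\mu_\alpha$ and $$\mathcal S_v(f,f)=\frac{C_{d,\alpha}}{2}\iint_{\mathbb R^d\times\mathbb R^d}\frac{\big[(f\mu_\alpha^{-1})(v)-(f\mu_\alpha^{-1})(w)\big]^2}{|v-w|^{d+\alpha}}\,\mu_\alpha(v)\,dw\,dv\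 \in[0,\infty],\qquad C_{d,\alpha}=\frac{2^\alpha\,\Gamma(\frac{d+\alpha}{2})}{\pi^{d/2}\,|\Gamma(-\frac{\alpha}{2})|}.$$ For $s\in(0,1)$ let $\|g\|_{H^s}^2=\|g\|_{L^2}^2+\|(-\Delta)^{s/2}g\|_{L^2}^2$, with the value $\infty$ if $g\notin H^s(\mathbb R^d)$. Then there is a constant $C_F>0$ depending only on $\alpha$ and $d$ such that for all $f\in D(L_\alpha)$, $$\big\|(f-\Pi f)\,\mu_\alpha^{-1/2}\big\|_{H^{\alpha/2}}^2\ \le\ C_F\,\mathcal S_v(f,f).$$ In particular, if $\mathcal S_v(f,f)<\infty$ then $(f-\Pi f)\mu_\alpha^{-1/2}\in H^{\alpha/2}(\mathbb R^d)$. -/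

import Mathlib

open MeasureTheory FourierTransform SchwartzMap
open scoped ENNReal

noncomputable section

namespace LevyFP

/-- The velocity space `ℝ^d` with its Euclidean norm. -/
abbrev Vel (d : ℕ) : Type := EuclideanSpace ℝ (Fin d)

/-- The complex space `L²(ℝ^d)` for Lebesgue measure. -/
abbrev L2 (d : ℕ) : Type := Lp (α := Vel d) ℂ 2 volume

/-- The symbol of `(-Δ)^{a/2}`. It is `|ξ|^a` for the Fourier transform with kernel `e^{-i v·ξ}`;
Mathlib's transform `𝓕` has the kernel `e^{-2πi v·ξ}`, whence the factor `2π`. -/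
def symbol {d : ℕ} (a : ℝ) (ξ : Vel d) : ℝ := (2 * Real.pi * ‖ξ‖) ^ a

/-- The fractional Laplacian `(-Δ)^{a/2} φ` of a Schwartz function, as a Fourier multiplier. -/
def fracLaplacian {d : ℕ} (a : ℝ) (φ : 𝓢(Vel d, ℂ)) : Vel d → ℂ :=
  𝓕⁻ (fun ξ : Vel d => (symbol a ξ : ℂ) * 𝓕 (φ : Vel d → ℂ) ξ)

/-- For `g, u ∈ L²(ℝ^d)`: `u = (-Δ)^{a/2} g`, that is `û = |ξ|^a ĝ` almost everywhere. -/
def IsFracLaplacian {d : ℕ} (a : ℝ) (g u : L2 d) : Prop :=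
  ∀ᵐ ξ ∂(volume : Measure (Vel d)),
    (𝓕 u : L2 d) ξ = (symbol a ξ : ℂ) * (𝓕 g : L2 d) ξ

/-- The squared norm `‖g‖²_{H^s} = ‖g‖²_{L²} + ‖(-Δ)^{s/2} g‖²_{L²}`. The infimum is over at most one
pair `(G, u)`: the class `G` of `g` in `L²`, and `u = (-Δ)^{s/2} G`. It is `∞` when `g` is not in
`L²` or `(-Δ)^{s/2} g` is not in `L²`, i.e. when `g ∉ H^s`. -/
def sobolevNormSq {d : ℕ} (s : ℝ) (g : Vel d → ℝ) : ℝ≥0∞ :=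
  ⨅ (G : L2 d) (u : L2 d) (_ : ∀ᵐ v ∂(volume : Measure (Vel d)), G v = (g v : ℂ))
    (_ : IsFracLaplacian s G u),
    ENNReal.ofReal (‖G‖ ^ 2 + ‖u‖ ^ 2)

/-- The inverse Fourier transform of `e^{-|ξ|^α/α}`. -/
def stableProfile (d : ℕ) (α : ℝ) (v : Vel d) : ℝ :=
  (𝓕⁻ (fun ξ : Vel d => (Real.exp (-(symbol α ξ) / α) : ℂ)) v).re

/-- The equilibrium `μ_α`: the inverse Fourier transform of `e^{-|ξ|^α/α}`, of total mass one. -/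
def equilibrium (d : ℕ) (α : ℝ) (v : Vel d) : ℝ :=
  (∫ w, stableProfile d α w)⁻¹ * stableProfile d α v

/-- The weighted space `L²(μ_α⁻¹)`. -/
def MemWeightedL2 {d : ℕ} (α : ℝ) (f : Vel d → ℝ) : Prop :=
  AEStronglyMeasurable f volume ∧ Integrable (fun v => f v ^ 2 * (equilibrium d α v)⁻¹) volume

/-- `L_α f = ∇·(v f) - (-Δ)^{α/2} f = g` in the sense of (tempered) distributions. -/
def IsLevyFokkerPlanck {d : ℕ} (α : ℝ) (f g : Vel d → ℝ) : Prop :=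
  ∀ φ : 𝓢(Vel d, ℂ),
    ∫ v, (g v : ℂ) * φ v =
      ∫ v, (f v : ℂ) * (-(fderiv ℝ (φ : Vel d → ℂ) v v) - fracLaplacian α φ v)

/-- The domain `D(L_α)` of `L_α` in `L²(μ_α⁻¹)`: both `f` and `L_α f` are in `L²(μ_α⁻¹)`. -/
def MemDomain {d : ℕ} (α : ℝ) (f : Vel d → ℝ) : Prop :=
  MemWeightedL2 α f ∧ ∃ g : Vel d → ℝ, MemWeightedL2 α g ∧ IsLevyFokkerPlanck α f g

/-- The projection `Π f = (∫ f) μ_α` onto the nullspace of `L_α`. -/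
def proj {d : ℕ} (α : ℝ) (f : Vel d → ℝ) (v : Vel d) : ℝ :=
  (∫ w, f w) * equilibrium d α v

/-- The constant `C_{d,α}` of the singular integral representation of `(-Δ)^{α/2}`. -/
def fracConst (d : ℕ) (α : ℝ) : ℝ :=
  2 ^ α * Real.Gamma ((d + α) / 2) / (Real.pi ^ ((d : ℝ) / 2) * |Real.Gamma (-α / 2)|)

/-- The dissipation `S_v(f, f)`, an integral of a non-negative function, with values in `[0, ∞]`. -/
def dissipation {d : ℕ} (α : ℝ) (f : Vel d → ℝ) : ℝ≥0∞ :=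
  ENNReal.ofReal (fracConst d α / 2) *
    ∫⁻ v : Vel d, ∫⁻ w : Vel d, ENNReal.ofReal
      ((f v * (equilibrium d α v)⁻¹ - f w * (equilibrium d α w)⁻¹) ^ 2
        / ‖v - w‖ ^ ((d : ℝ) + α) * equilibrium d α v)

end LevyFP

end

/-!
Write `μ` for the equilibrium, `K = d + α` and `h = f / μ - ∫ f`, so that `∫ h μ = 0` and the function
whose `H^{α/2}` norm is wanted is `h √μ`. The dissipation is, up to a constant factor, the jump form
`∬ (h(v) - h(w))² |v - w|^{-K} μ(v) dw dv`. Apart from `∫ μ = 1`, the argument uses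
only the properties of `μ` collected in `HasStableBounds`: the two-sided bound `μ ≍ (1 + |v|)^{-K}`
and the estimate `|μ(v) - μ(w)| ≤ A |v - w| μ(w)` for `|v - w| ≤ 1`.

*The inequality.* The upper bound gives `μ(v) μ(w) |v - w|^K ≤ C (μ(v) + μ(w))`, so the variance of `h`,
as a double integral against `μ ⊗ μ`, is bounded by the jump form; this is the Poincaré inequality
`HasStableBounds.lintegral_sq_mul_le`. For the seminorm, split
`h(v)√μ(v) - h(w)√μ(w) = (h(v) - h(w)) √μ(v) + h(w) (√μ(v) - √μ(w))`. The first part gives the jump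
form. The second is bounded by `∫ h² μ`, hence by the jump form again, because
`∫ (√μ(v) - √μ(w))² |v - w|^{-K} dv ≤ C μ(w)`: near `w` by the Lipschitz estimate, far from `w` by the
two-sided bound (`HasStableBounds.sq_sqrt_sub_sqrt_div_le`). The Gagliardo seminorm dominates the
norm of `(-Δ)^{α/4}` by Plancherel's theorem applied to the differences `g(· - z) - g`
(`exists_sobolevNormSq_le`).

*The bounds on `μ`.* They come from subordination: `e^{-s^{α/2}/α}` is the Laplace transform of a
probability measure `ν` on `(0, ∞)`, so `μ` is, up to normalization, the mixture `∫ G_t dν(t)` of heat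
kernels (`exists_stableProfile_eq_integral_heatKernel`). The measure `ν` is obtained as a stable limit:
the density `t^{-1-b} (1 - e^{-t})` has the explicit transform `(1 + s)^b - s^b = 1 - s^b + O(s)`, and the
rescaled powers of this transform converge to `e^{-s^b}`. Given `ν`, a pointwise inequality in `t`
between a heat kernel and a combination of exponentials `e^{-st}` becomes, after integration,
a bound on `μ` in terms of the known Laplace transform; by scaling, one inequality for each of the
upper bound, the lower bound and the Lipschitz estimate suffices
(`exists_hasStableBounds_stableProfile`).
-/

noncomputable section

namespace LevyFP

open Filter Topology

/-! ### The one-sided stable law -/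

/-- `F` is the Laplace transform, on `(0,∞)`, of a probability measure carried by `[0,∞)`. -/
def IsLaplaceTransform (F : ℝ → ℝ) : Prop :=
  ∃ ν : Measure ℝ, IsProbabilityMeasure ν ∧ (∀ᵐ t ∂ν, 0 ≤ t) ∧
    ∀ s, 0 < s → ∫ t, Real.exp (-(s * t)) ∂ν = F s

theorem IsLaplaceTransform.one : IsLaplaceTransform 1 :=
  ⟨Measure.dirac 0, inferInstance, by simp [ae_dirac_eq], fun s _ => by simp⟩

theorem IsLaplaceTransform.mul {F G : ℝ → ℝ} (hF : IsLaplaceTransform F)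
    (hG : IsLaplaceTransform G) : IsLaplaceTransform (F * G) := by
  obtain ⟨μ, hμ, hμ0, hμF⟩ := hF
  obtain ⟨ν, hν, hν0, hνG⟩ := hG
  have hm : Measurable fun p : ℝ × ℝ => p.1 + p.2 := measurable_add
  refine ⟨(μ.prod ν).map (fun p => p.1 + p.2), Measure.isProbabilityMeasure_map hm.aemeasurable,
    ?_, fun s hs => ?_⟩
  · rw [ae_map_iff hm.aemeasurable measurableSet_Ici]
    filter_upwards [Measure.quasiMeasurePreserving_fst.ae hμ0,
      Measure.quasiMeasurePreserving_snd.ae hν0] with p h1 h2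
    exact add_nonneg h1 h2
  · rw [integral_map hm.aemeasurable (by fun_prop)]
    simp only [mul_add, neg_add, Real.exp_add]
    rw [integral_prod_mul (fun x => Real.exp (-(s * x))) (fun y => Real.exp (-(s * y))),
      hμF s hs, hνG s hs]
    rfl

theorem IsLaplaceTransform.pow {F : ℝ → ℝ} (hF : IsLaplaceTransform F) (n : ℕ) :
    IsLaplaceTransform (F ^ n) := by
  induction n with
  | zero => simpa using IsLaplaceTransform.one
  | succ n ih => rw [pow_succ]; exact ih.mul hF

theorem IsLaplaceTransform.comp_mul {F : ℝ → ℝ} (hF : IsLaplaceTransform F) {c : ℝ} (hc : 0 < c) :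
    IsLaplaceTransform fun s => F (c * s) := by
  obtain ⟨μ, hμ, hμ0, hμF⟩ := hF
  have hm : Measurable fun t : ℝ => c * t := measurable_const_mul c
  refine ⟨μ.map (fun t => c * t), Measure.isProbabilityMeasure_map hm.aemeasurable,
    ?_, fun s hs => ?_⟩
  · rw [ae_map_iff hm.aemeasurable measurableSet_Ici]
    filter_upwards [hμ0] with t h
    exact mul_nonneg hc.le h
  · rw [integral_map hm.aemeasurable (by fun_prop)]
    refine Eq.trans ?_ (hμF _ (mul_pos hc hs))
    refine integral_congr_ae (.of_forall fun t => ?_)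
    ring_nf

/-- The continuity theorem for Laplace transforms. In the variable `x = e^{-t} ∈ [0,1]` it is the
compactness of the space of probability measures on the unit interval; that `F → 1` at `0`
excludes an atom at `x = 0`, that is at `t = ∞`. -/
theorem IsLaplaceTransform.of_tendsto {F : ℕ → ℝ → ℝ} {G : ℝ → ℝ}
    (hF : ∀ n, IsLaplaceTransform (F n))
    (h : ∀ s, 0 < s → Tendsto (fun n => F n s) atTop (𝓝 (G s)))
    (hG : Tendsto G (𝓝[>] 0) (𝓝 1)) : IsLaplaceTransform G := by
  choose ν hν hν0 hνF using hF
  let e : ℝ → unitInterval := fun t => ⟨Real.exp (-(max t 0)), (Real.exp_pos _).le,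
    Real.exp_le_one_iff.2 (neg_nonpos.2 (le_max_right _ _))⟩
  have he : Measurable e := Measurable.subtype_mk (by fun_prop)
  let ρ : ℕ → ProbabilityMeasure unitInterval := fun n =>
    ⟨(ν n).map e, Measure.isProbabilityMeasure_map he.aemeasurable⟩
  let U : Ultrafilter ℕ := Ultrafilter.of atTop
  have hU : (U : Filter ℕ) ≤ atTop := Ultrafilter.of_le _
  obtain ⟨σ, -, hσ⟩ := (isCompact_univ (X := ProbabilityMeasure unitInterval)).ultrafilter_le_nhds
    (U.map ρ) (by simp)
  have hσ' : Tendsto ρ U (𝓝 σ) := hσ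
  have hcont {s : ℝ} (hs : 0 < s) : Continuous fun x : unitInterval => (x : ℝ) ^ s :=
    (Real.continuous_rpow_const hs.le).comp continuous_subtype_val
  have hσG (s : ℝ) (hs : 0 < s) : ∫ x, (x : ℝ) ^ s ∂(σ : Measure unitInterval) = G s := by
    have h1 := (ProbabilityMeasure.tendsto_iff_forall_integral_tendsto.1 hσ')
      (BoundedContinuousFunction.mkOfCompact ⟨_, hcont hs⟩)
    refine tendsto_nhds_unique h1 (((h s hs).mono_left hU).congr fun n => ?_)
    rw [← hνF n s hs]
    change _ = ∫ x, (x : ℝ) ^ s ∂((ν n).map e)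
    rw [integral_map he.aemeasurable (hcont hs).aestronglyMeasurable]
    refine integral_congr_ae ?_
    filter_upwards [hν0 n] with t ht
    change _ = Real.exp (-(max t 0)) ^ s
    rw [max_eq_left ht, ← Real.exp_mul]
    ring_nf
  have hσ0 : (σ : Measure unitInterval) {0} = 0 := by
    have hle (s : ℝ) (hs : 0 < s) : G s ≤ (σ : Measure unitInterval).real {0}ᶜ := by
      rw [← hσG s hs, ← integral_indicator_one (measurableSet_singleton 0).compl]
      refine integral_mono_ae ((hcont hs).integrable_of_hasCompactSupport
        (HasCompactSupport.of_compactSpace _)) ?_ (.of_forall fun x => ?_)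
      · exact (integrable_const 1).indicator (measurableSet_singleton 0).compl
      · by_cases hx : x = 0
        · simp [hx, Real.zero_rpow hs.ne']
        · have : x ∈ ({0}ᶜ : Set unitInterval) := hx
          simp only [Set.indicator_of_mem this, Pi.one_apply]
          exact Real.rpow_le_one x.2.1 x.2.2 hs.le
    have h1 : 1 ≤ (σ : Measure unitInterval).real {0}ᶜ :=
      le_of_tendsto hG (eventually_mem_nhdsWithin.mono fun s hs => hle s hs)
    rw [probReal_compl_eq_one_sub (measurableSet_singleton 0)] at h1
    have h2 : (σ : Measure unitInterval).real {0} = 0 :=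
      le_antisymm (by linarith) measureReal_nonneg
    exact (measureReal_eq_zero_iff).1 h2
  have hl : Measurable fun x : unitInterval => -Real.log x :=
    (Real.measurable_log.comp measurable_subtype_coe).neg
  refine ⟨(σ : Measure unitInterval).map (fun x : unitInterval => -Real.log x),
    Measure.isProbabilityMeasure_map hl.aemeasurable, ?_, fun s hs => ?_⟩
  · rw [ae_map_iff hl.aemeasurable measurableSet_Ici]
    exact .of_forall fun x => neg_nonneg.2 (Real.log_nonpos x.2.1 x.2.2)
  · rw [integral_map hl.aemeasurable (by fun_prop), ← hσG s hs]
    refine integral_congr_ae ?_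
    have : ∀ᵐ x ∂(σ : Measure unitInterval), x ≠ 0 := by
      rw [ae_iff]; simpa using hσ0
    filter_upwards [this] with x hx
    have hx0 : (0 : ℝ) < x := unitInterval.pos_iff_ne_zero.2 hx
    rw [Real.rpow_def_of_pos hx0]
    ring_nf

/-- The density `t^{-1-b}(1-e^{-t})` has the Laplace transform `Γ(1-b)/b · ((1+s)^b - s^b)`. -/
theorem lintegral_rpow_mul_one_sub_exp {b s : ℝ} (hb₀ : 0 < b) (hb₁ : b < 1) (hs : 0 ≤ s) :
    ∫⁻ t in Set.Ioi (0 : ℝ), ENNReal.ofReal (t ^ (-1 - b) * (1 - Real.exp (-t)) * Real.exp (-(s * t)))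
      = ENNReal.ofReal (Real.Gamma (1 - b) / b * ((1 + s) ^ b - s ^ b)) := by
  have hΓ : 0 < Real.Gamma (1 - b) := Real.Gamma_pos_of_pos (by linarith)
  have h1 : ∀ t ∈ Set.Ioi (0 : ℝ),
      ENNReal.ofReal (t ^ (-1 - b) * (1 - Real.exp (-t)) * Real.exp (-(s * t))) =
      ∫⁻ u in Set.Ioc s (1 + s), ENNReal.ofReal (t ^ (-b) * Real.exp (-(u * t))) := by
    intro t ht
    have ht' : 0 < t := ht
    rw [← ofReal_integral_eq_lintegral_ofReal, ← intervalIntegral.integral_of_le (by linarith)]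
    · have hd : ∀ u ∈ Set.uIcc s (1 + s),
          HasDerivAt (fun u => -(t ^ (-1 - b) * Real.exp (-(u * t))))
            (t ^ (-b) * Real.exp (-(u * t))) u := by
        intro u _
        have := (((hasDerivAt_id u).mul_const t).neg.exp.const_mul (t ^ (-1 - b))).neg
        refine this.congr_deriv ?_
        have e : t ^ (-b) = t ^ (-1 - b) * t := by
          rw [← Real.rpow_add_one ht'.ne']; ring_nf
        rw [e]; simp; ring
      rw [intervalIntegral.integral_eq_sub_of_hasDerivAt hd
        ((by fun_prop : Continuous fun u => t ^ (-b) * Real.exp (-(u * t))).intervalIntegrable _ _)]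
      congr 1
      have e : Real.exp (-((1 + s) * t)) = Real.exp (-t) * Real.exp (-(s * t)) := by
        rw [← Real.exp_add]; ring_nf
      rw [e]; ring
    · exact (by fun_prop : Continuous fun u => t ^ (-b) * Real.exp (-(u * t))).integrableOn_Ioc
    · exact .of_forall fun u => by positivity
  have hmeas : Measurable fun p : ℝ × ℝ => ENNReal.ofReal (p.1 ^ (-b) * Real.exp (-(p.2 * p.1))) := by
    fun_prop
  rw [setLIntegral_congr_fun measurableSet_Ioi h1, lintegral_lintegral_swap hmeas.aemeasurable]
  have h2 : ∀ u ∈ Set.Ioc s (1 + s),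
      ∫⁻ t in Set.Ioi (0 : ℝ), ENNReal.ofReal (t ^ (-b) * Real.exp (-(u * t))) =
        ENNReal.ofReal (Real.Gamma (1 - b) * u ^ (b - 1)) := by
    intro u hu
    have hu0 : 0 < u := hs.trans_lt hu.1
    have hI := Real.integral_rpow_mul_exp_neg_mul_Ioi (a := 1 - b) (by linarith) hu0
    have e : (1 - b) - 1 = -b := by ring
    rw [e] at hI
    rw [← ofReal_integral_eq_lintegral_ofReal, hI]
    · congr 1
      rw [one_div, Real.inv_rpow hu0.le, ← Real.rpow_neg hu0.le]; ring_nf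
    · by_contra hni
      rw [integral_undef hni] at hI
      have : 0 < (1 / u) ^ (1 - b) * Real.Gamma (1 - b) := by positivity
      linarith
    · refine (ae_restrict_mem measurableSet_Ioi).mono fun t ht => ?_
      have : (0 : ℝ) < t := ht
      change 0 ≤ t ^ (-b) * Real.exp (-(u * t))
      positivity
  rw [setLIntegral_congr_fun measurableSet_Ioc h2, ← ofReal_integral_eq_lintegral_ofReal,
    ← intervalIntegral.integral_of_le (by linarith), intervalIntegral.integral_const_mul,
    integral_rpow (Or.inl (by linarith))]
  · congr 1
    rw [sub_add_cancel]; ring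
  · refine (intervalIntegrable_iff_integrableOn_Ioc_of_le (by linarith)).1 ?_
    exact (intervalIntegral.intervalIntegrable_rpow' (by linarith)).const_mul _
  · refine (ae_restrict_mem measurableSet_Ioc).mono fun u hu => ?_
    have : 0 < u := hs.trans_lt hu.1
    change 0 ≤ Real.Gamma (1 - b) * u ^ (b - 1)
    positivity

theorem isLaplaceTransform_one_add_rpow_sub {b : ℝ} (hb₀ : 0 < b) (hb₁ : b < 1) :
    IsLaplaceTransform fun s => (1 + s) ^ b - s ^ b := by
  have hΓ : 0 < Real.Gamma (1 - b) := Real.Gamma_pos_of_pos (by linarith)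
  set ρ : ℝ → ℝ := fun t => b / Real.Gamma (1 - b) * (t ^ (-1 - b) * (1 - Real.exp (-t))) with hρ
  have hρm : Measurable ρ := by fun_prop
  have hρ0 : ∀ t ∈ Set.Ioi (0 : ℝ), 0 ≤ ρ t := by
    intro t ht
    have ht' : (0 : ℝ) < t := ht
    have : 0 ≤ 1 - Real.exp (-t) := by
      rw [sub_nonneg]; exact Real.exp_le_one_iff.2 (by linarith)
    positivity
  set ν : Measure ℝ := (volume.restrict (Set.Ioi (0 : ℝ))).withDensity
    (fun t => ENNReal.ofReal (ρ t)) with hνdef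
  have hL (s : ℝ) (hs : 0 ≤ s) : ∫⁻ t, ENNReal.ofReal (Real.exp (-(s * t))) ∂ν =
      ENNReal.ofReal ((1 + s) ^ b - s ^ b) := by
    rw [hνdef, lintegral_withDensity_eq_lintegral_mul _ hρm.ennreal_ofReal (by fun_prop)]
    have e : ∀ t ∈ Set.Ioi (0 : ℝ), ((fun t => ENNReal.ofReal (ρ t)) *
        fun t => ENNReal.ofReal (Real.exp (-(s * t)))) t = ENNReal.ofReal (b / Real.Gamma (1 - b)) *
        ENNReal.ofReal (t ^ (-1 - b) * (1 - Real.exp (-t)) * Real.exp (-(s * t))) := by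
      intro t ht
      rw [Pi.mul_apply, ← ENNReal.ofReal_mul (hρ0 t ht), ← ENNReal.ofReal_mul (by positivity), hρ]
      ring_nf
    rw [setLIntegral_congr_fun measurableSet_Ioi e, lintegral_const_mul _ (by fun_prop),
      lintegral_rpow_mul_one_sub_exp hb₀ hb₁ hs, ← ENNReal.ofReal_mul (by positivity)]
    congr 1
    field_simp
  refine ⟨ν, ⟨?_⟩, ?_, fun s hs => ?_⟩
  · simpa [Real.zero_rpow hb₀.ne'] using hL 0 le_rfl
  · refine (withDensity_absolutelyContinuous _ _).ae_le ?_
    exact (ae_restrict_mem measurableSet_Ioi).mono fun t ht => le_of_lt ht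
  · rw [integral_eq_lintegral_of_nonneg_ae (.of_forall fun t => (Real.exp_pos _).le)
      (by fun_prop), hL s hs.le, ENNReal.toReal_ofReal]
    rw [sub_nonneg]
    exact Real.rpow_le_rpow hs.le (by linarith) hb₀.le

/-- The stable limit theorem: a sum of `n` independent copies, rescaled by `n^{-1/b}`, has the
transform `F(s n^{-1/b})^n` with `F(s) = 1 - s^b + O(s)`, and this tends to `e^{-s^b}`. -/
theorem isLaplaceTransform_exp_neg_rpow {b : ℝ} (hb₀ : 0 < b) (hb₁ : b < 1) :
    IsLaplaceTransform fun s => Real.exp (-s ^ b) := by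
  set F : ℝ → ℝ := fun s => (1 + s) ^ b - s ^ b with hFdef
  have hF := isLaplaceTransform_one_add_rpow_sub hb₀ hb₁
  have hN (n : ℕ) : 0 < ((n : ℝ) + 1) ^ (-1 / b) := by positivity
  refine IsLaplaceTransform.of_tendsto
    (F := fun n s => (F (((n : ℝ) + 1) ^ (-1 / b) * s)) ^ (n + 1))
    (fun n => (hF.comp_mul (hN n)).pow (n + 1)) (fun s hs => ?_) ?_
  · refine (tendsto_add_atTop_iff_nat (f := fun n : ℕ => F ((n : ℝ) ^ (-1 / b) * s) ^ n) 1).2 ?_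
      |>.congr fun n => by push_cast; rfl
    have key := Real.tendsto_one_add_pow_exp_of_tendsto
      (g := fun n : ℕ => F ((n : ℝ) ^ (-1 / b) * s) - 1) (t := -s ^ b) ?_
    · simpa using key
    have h1 : Tendsto (fun n : ℕ => b * s * (n : ℝ) ^ (-(1 / b - 1))) atTop (𝓝 0) := by
      have := ((tendsto_rpow_neg_atTop (y := 1 / b - 1) (by
        rw [sub_pos, lt_div_iff₀ hb₀]; linarith)).comp tendsto_natCast_atTop_atTop).const_mul (b * s)
      simpa using this
    have h2 : Tendsto (fun n : ℕ => (n : ℝ) * ((1 + (n : ℝ) ^ (-1 / b) * s) ^ b - 1)) atTop (𝓝 0) := by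
      refine tendsto_of_tendsto_of_tendsto_of_le_of_le' tendsto_const_nhds h1 ?_ ?_
      · refine .of_forall fun n => mul_nonneg (Nat.cast_nonneg n) (sub_nonneg.2 ?_)
        exact Real.one_le_rpow (by have : 0 ≤ (n : ℝ) ^ (-1 / b) * s := by positivity
                                   linarith) hb₀.le
      · filter_upwards [eventually_gt_atTop 0] with n hn
        have hn' : (0 : ℝ) < n := Nat.cast_pos.2 hn
        have hx : 0 ≤ (n : ℝ) ^ (-1 / b) * s := by positivity
        have hB := rpow_one_add_le_one_add_mul_self (s := (n : ℝ) ^ (-1 / b) * s)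
          (by linarith) hb₀.le hb₁.le
        have e : (n : ℝ) ^ (-(1 / b - 1)) = n * (n : ℝ) ^ (-1 / b) := by
          rw [mul_comm, ← Real.rpow_add_one hn'.ne']; ring_nf
        rw [e]
        calc _ ≤ (n : ℝ) * (b * ((n : ℝ) ^ (-1 / b) * s)) :=
              mul_le_mul_of_nonneg_left (by linarith) hn'.le
          _ = _ := by ring
    have h3 := h2.sub_const (s ^ b)
    rw [zero_sub] at h3
    refine h3.congr' ?_
    filter_upwards [eventually_gt_atTop 0] with n hn
    have hn' : (0 : ℝ) < n := Nat.cast_pos.2 hn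
    have e : (n : ℝ) * ((n : ℝ) ^ (-1 / b) * s) ^ b = s ^ b := by
      rw [Real.mul_rpow (by positivity) hs.le, ← Real.rpow_mul hn'.le, div_mul_cancel₀ _ hb₀.ne',
        Real.rpow_neg_one, ← mul_assoc, mul_inv_cancel₀ hn'.ne', one_mul]
    simp only [hFdef]
    linear_combination e
  · have : Tendsto (fun s : ℝ => Real.exp (-s ^ b)) (𝓝 0) (𝓝 (Real.exp (-(0 : ℝ) ^ b))) :=
      (((Real.continuous_rpow_const hb₀.le).neg).rexp).tendsto 0
    rw [Real.zero_rpow hb₀.ne', neg_zero, Real.exp_zero] at this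
    exact this.mono_left nhdsWithin_le_nhds

/-- The law of the random time. It carries no mass at `0`, where the heat kernel is singular, because
its Laplace transform tends to `0` at infinity. -/
theorem exists_subordinator {b a : ℝ} (hb₀ : 0 < b) (hb₁ : b < 1) (ha : 0 < a) :
    ∃ ν : Measure ℝ, IsProbabilityMeasure ν ∧ (∀ᵐ t ∂ν, 0 < t) ∧
      ∀ s, 0 ≤ s → ∫ t, Real.exp (-(s * t)) ∂ν = Real.exp (-s ^ b / a) := by
  obtain ⟨ν, hν, hν0, hνF⟩ := (isLaplaceTransform_exp_neg_rpow hb₀ hb₁).comp_mul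
    (c := a ^ (-1 / b)) (by positivity)
  have hL (s : ℝ) (hs : 0 < s) : ∫ t, Real.exp (-(s * t)) ∂ν = Real.exp (-s ^ b / a) := by
    refine (hνF s hs).trans ?_
    beta_reduce
    rw [Real.mul_rpow (by positivity) hs.le, ← Real.rpow_mul ha.le,
      div_mul_cancel₀ _ hb₀.ne', Real.rpow_neg_one]
    ring_nf
  refine ⟨ν, hν, ?_, fun s hs => ?_⟩
  · have hle (s : ℝ) (hs : 0 < s) : ν.real {0} ≤ Real.exp (-s ^ b / a) := by
      rw [← hL s hs, ← integral_indicator_one (measurableSet_singleton 0)]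
      refine integral_mono_ae ((integrable_const 1).indicator (measurableSet_singleton 0)) ?_
        (.of_forall fun t => ?_)
      · refine Integrable.of_bound (by fun_prop) 1 ?_
        filter_upwards [hν0] with t ht
        rw [Real.norm_of_nonneg (Real.exp_pos _).le]
        exact Real.exp_le_one_iff.2 (neg_nonpos.2 (mul_nonneg hs.le ht))
      · by_cases ht : t = 0
        · simp [ht]
        · have : t ∉ ({0} : Set ℝ) := ht
          simp only [Set.indicator_of_notMem this]
          exact (Real.exp_pos _).le
    have hlim : Tendsto (fun s : ℝ => Real.exp (-s ^ b / a)) atTop (𝓝 0) := by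
      refine Real.tendsto_exp_atBot.comp ?_
      exact (tendsto_neg_atTop_atBot.comp (tendsto_rpow_atTop hb₀)).atBot_div_const ha
    have h0 : ν.real {0} = 0 := le_antisymm (ge_of_tendsto hlim
      ((eventually_gt_atTop 0).mono fun s hs => hle s hs)) measureReal_nonneg
    have h1 : ∀ᵐ t ∂ν, t ≠ 0 := by
      rw [ae_iff]; simpa using (measureReal_eq_zero_iff (by simp)).1 h0
    filter_upwards [hν0, h1] with t h2 h3
    exact lt_of_le_of_ne h2 h3.symm
  · rcases hs.eq_or_lt with rfl | hs
    · simp [Real.zero_rpow hb₀.ne']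
    · exact hL s hs

/-! ### Subordination of the Gaussian -/

theorem nontrivial_vel {d : ℕ} (hd : 1 ≤ d) : Nontrivial (Vel d) :=
  Module.nontrivial_of_finrank_pos (R := ℝ) (by rw [finrank_euclideanSpace_fin]; exact hd)

theorem integrable_norm_pow_mul_exp_neg_symbol {d : ℕ} (hd : 1 ≤ d) {α : ℝ} (hα : 0 < α) (k : ℕ) :
    Integrable fun ξ : Vel d => ‖ξ‖ ^ k * Real.exp (-(symbol α ξ) / α) := by
  have := nontrivial_vel hd
  have h := (integrable_fun_norm_addHaar (volume : Measure (Vel d))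
    (f := fun r : ℝ => r ^ k * Real.exp (-((2 * Real.pi) ^ α / α) * r ^ α))).2 ?_
  · refine h.congr (.of_forall fun ξ => ?_)
    simp only [symbol]
    rw [Real.mul_rpow (by positivity) (norm_nonneg _)]
    ring_nf
  · have h := integrableOn_rpow_mul_exp_neg_mul_rpow (p := α) (s := ((d - 1 + k : ℕ) : ℝ))
      (b := (2 * Real.pi) ^ α / α) (by linarith [(d - 1 + k).cast_nonneg (α := ℝ)]) hα
      (by positivity)
    refine h.congr_fun (fun y _ => ?_) measurableSet_Ioi
    simp only [Real.rpow_natCast, finrank_euclideanSpace_fin, smul_eq_mul]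
    rw [← mul_assoc, ← pow_add]

/-- The heat kernel of `ℝ^d` at time `t`, as a function of the distance `r` to the origin. -/
def heatKernel (d : ℕ) (t r : ℝ) : ℝ :=
  (4 * Real.pi * t) ^ (-(d : ℝ) / 2) * Real.exp (-(r ^ 2 / (4 * t)))

theorem heatKernel_nonneg (d : ℕ) {t : ℝ} (ht : 0 < t) (r : ℝ) : 0 ≤ heatKernel d t r := by
  unfold heatKernel; positivity

/-- The heat kernel at time `t` is the inverse Fourier transform of `e^{-t|ξ|²}`. -/
theorem integral_cexp_mul_exp_neg_mul_sq {d : ℕ} {t : ℝ} (ht : 0 < t) (v : Vel d) :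
    ∫ ξ : Vel d, Complex.exp (((2 * Real.pi * inner ℝ ξ v : ℝ) : ℂ) * Complex.I) *
      ((Real.exp (-((2 * Real.pi * ‖ξ‖) ^ 2 * t)) : ℝ) : ℂ) = (heatKernel d t ‖v‖ : ℂ) := by
  have hb : 0 < 4 * Real.pi ^ 2 * t := by positivity
  have h := GaussianFourier.integral_cexp_neg_mul_sq_norm_add (V := Vel d)
    (b := ((4 * Real.pi ^ 2 * t : ℝ) : ℂ)) (by rw [Complex.ofReal_re]; exact hb)
    (2 * Real.pi * Complex.I) v
  refine (integral_congr_ae (.of_forall fun ξ => ?_)).trans (h.trans ?_)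
  · simp only [Complex.ofReal_exp]
    rw [← Complex.exp_add, real_inner_comm]
    congr 1
    push_cast
    ring
  · rw [heatKernel, finrank_euclideanSpace_fin, ← Complex.ofReal_div]
    have e1 : Real.pi / (4 * Real.pi ^ 2 * t) = (4 * Real.pi * t)⁻¹ := by
      have := Real.pi_pos
      field_simp
    have e2 : (2 * Real.pi * Complex.I) ^ 2 * (‖v‖ : ℂ) ^ 2 / (4 * ((4 * Real.pi ^ 2 * t : ℝ) : ℂ)) =
        ((-(‖v‖ ^ 2 / (4 * t)) : ℝ) : ℂ) := by
      have h1 : (t : ℂ) ≠ 0 := by exact_mod_cast ht.ne'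
      have h2 : (Real.pi : ℂ) ≠ 0 := by exact_mod_cast Real.pi_ne_zero
      rw [mul_pow, Complex.I_sq]
      push_cast
      field_simp
      ring
    rw [e1, e2, ← Complex.ofReal_exp, Complex.ofReal_mul]
    congr 1
    have e3 : ((d : ℂ) / 2) = (((d : ℝ) / 2 : ℝ) : ℂ) := by push_cast; rfl
    rw [e3, ← Complex.ofReal_cpow (by positivity), Real.inv_rpow (by positivity),
      ← Real.rpow_neg (by positivity), neg_div]

theorem stableProfile_eq_re_integral (d : ℕ) (α : ℝ) (v : Vel d) :
    stableProfile d α v = (∫ ξ : Vel d, Complex.exp (((2 * Real.pi * inner ℝ ξ v : ℝ) : ℂ) *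
      Complex.I) * ((Real.exp (-(symbol α ξ) / α) : ℝ) : ℂ)).re := by
  rw [stableProfile, Real.fourierInv_eq']
  rfl

/-- Subordination: the stable profile is a mixture of heat kernels, the random time having the
Laplace transform `e^{-s^{α/2}/α}`. -/
theorem exists_stableProfile_eq_integral_heatKernel {d : ℕ} (hd : 1 ≤ d) {α : ℝ}
    (hα₀ : 0 < α) (hα₂ : α < 2) :
    ∃ ν : Measure ℝ, IsProbabilityMeasure ν ∧ (∀ᵐ t ∂ν, 0 < t) ∧
      (∀ s, 0 ≤ s → ∫ t, Real.exp (-(s * t)) ∂ν = Real.exp (-s ^ (α / 2) / α)) ∧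
      ∀ v : Vel d, Integrable (fun t => heatKernel d t ‖v‖) ν ∧
        stableProfile d α v = ∫ t, heatKernel d t ‖v‖ ∂ν := by
  obtain ⟨ν, hν, hν0, hνL⟩ := exists_subordinator (b := α / 2) (a := α) (by positivity)
    (by linarith) hα₀
  refine ⟨ν, hν, hν0, hνL, fun v => ?_⟩
  have hsym (ξ : Vel d) : ((2 * Real.pi * ‖ξ‖) ^ 2) ^ (α / 2) = symbol α ξ := by
    rw [symbol, ← Real.rpow_natCast, ← Real.rpow_mul (by positivity)]
    congr 1; push_cast; ring
  have hL (ξ : Vel d) : ∫ t, Real.exp (-((2 * Real.pi * ‖ξ‖) ^ 2 * t)) ∂ν =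
      Real.exp (-(symbol α ξ) / α) := by
    rw [hνL _ (by positivity), hsym]
  set Φ : Vel d → ℝ → ℂ := fun ξ t =>
    Complex.exp (((2 * Real.pi * inner ℝ ξ v : ℝ) : ℂ) * Complex.I) *
      ((Real.exp (-((2 * Real.pi * ‖ξ‖) ^ 2 * t)) : ℝ) : ℂ) with hΦ
  have hnorm (ξ : Vel d) (t : ℝ) : ‖Φ ξ t‖ = Real.exp (-((2 * Real.pi * ‖ξ‖) ^ 2 * t)) := by
    rw [hΦ, norm_mul, Complex.norm_exp_ofReal_mul_I, one_mul, Complex.norm_real,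
      Real.norm_of_nonneg (Real.exp_pos _).le]
  have hΦc : Continuous (Function.uncurry Φ) := by
    simp only [hΦ, Function.uncurry_def]
    fun_prop
  have hint : Integrable (Function.uncurry Φ) (volume.prod ν) := by
    refine (integrable_prod_iff hΦc.aestronglyMeasurable).2 ⟨.of_forall fun ξ => ?_, ?_⟩
    · refine Integrable.of_bound
        (hΦc.comp (Continuous.prodMk_right ξ)).aestronglyMeasurable 1 ?_
      filter_upwards [hν0] with t ht
      change ‖Φ ξ t‖ ≤ 1
      rw [hnorm]
      exact Real.exp_le_one_iff.2 (neg_nonpos.2 (by positivity))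
    · have := integrable_norm_pow_mul_exp_neg_symbol hd hα₀ 0
      refine this.congr (.of_forall fun ξ => ?_)
      simp only [Function.uncurry_apply_pair, hnorm, hL, pow_zero, one_mul]
  have hinner : (fun t => ∫ ξ, Φ ξ t) =ᵐ[ν] fun t => (heatKernel d t ‖v‖ : ℂ) := by
    filter_upwards [hν0] with t ht
    exact integral_cexp_mul_exp_neg_mul_sq ht v
  constructor
  · have := (hint.integral_prod_right.congr hinner).re
    simpa using this
  · rw [stableProfile_eq_re_integral]
    have e1 (ξ : Vel d) : Complex.exp (((2 * Real.pi * inner ℝ ξ v : ℝ) : ℂ) * Complex.I) *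
        ((Real.exp (-(symbol α ξ) / α) : ℝ) : ℂ) = ∫ t, Φ ξ t ∂ν := by
      rw [← hL, hΦ, integral_const_mul, ← integral_complex_ofReal]
    simp_rw [e1]
    rw [integral_integral_swap hint, integral_congr_ae hinner, integral_complex_ofReal,
      Complex.ofReal_re]

/-- The profile is Lipschitz, since `|ξ| e^{-|ξ|^α/α}` is integrable. -/
theorem exists_abs_stableProfile_sub_le {d : ℕ} (hd : 1 ≤ d) {α : ℝ} (hα : 0 < α) :
    ∃ C : ℝ, 0 ≤ C ∧ ∀ v w : Vel d,
      |stableProfile d α v - stableProfile d α w| ≤ C * ‖v - w‖ := by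
  have hI := integrable_norm_pow_mul_exp_neg_symbol (d := d) hd hα 1
  have hI0 := integrable_norm_pow_mul_exp_neg_symbol (d := d) hd hα 0
  simp only [pow_one, pow_zero, one_mul] at hI hI0
  set ψ : Vel d → Vel d → ℂ := fun v ξ =>
    Complex.exp (((2 * Real.pi * inner ℝ ξ v : ℝ) : ℂ) * Complex.I) *
      ((Real.exp (-(symbol α ξ) / α) : ℝ) : ℂ) with hψ
  have hψi (v : Vel d) : Integrable (ψ v) := by
    refine hI0.mono' ?_ (.of_forall fun ξ => ?_)
    · have hs : Continuous fun ξ : Vel d => symbol α ξ := by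
        unfold symbol
        exact (Real.continuous_rpow_const hα.le).comp (by fun_prop)
      exact Continuous.aestronglyMeasurable (by fun_prop)
    · rw [hψ, norm_mul, Complex.norm_exp_ofReal_mul_I, one_mul, Complex.norm_real,
        Real.norm_of_nonneg (Real.exp_pos _).le]
  refine ⟨2 * Real.pi * ∫ ξ : Vel d, ‖ξ‖ * Real.exp (-(symbol α ξ) / α), ?_, fun v w => ?_⟩
  · exact mul_nonneg (by positivity) (integral_nonneg fun ξ => by positivity)
  rw [stableProfile_eq_re_integral, stableProfile_eq_re_integral, ← Complex.sub_re,
    ← integral_sub (hψi v) (hψi w)]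
  refine (Complex.abs_re_le_norm _).trans ((norm_integral_le_integral_norm _).trans ?_)
  have hbd (ξ : Vel d) : ‖ψ v ξ - ψ w ξ‖ ≤
      2 * Real.pi * ‖v - w‖ * (‖ξ‖ * Real.exp (-(symbol α ξ) / α)) := by
    rw [hψ, ← sub_mul, norm_mul, Complex.norm_real, Real.norm_of_nonneg (Real.exp_pos _).le,
      ← mul_assoc]
    gcongr
    have e : Complex.exp (((2 * Real.pi * inner ℝ ξ v : ℝ) : ℂ) * Complex.I) -
        Complex.exp (((2 * Real.pi * inner ℝ ξ w : ℝ) : ℂ) * Complex.I) =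
        Complex.exp (((2 * Real.pi * inner ℝ ξ w : ℝ) : ℂ) * Complex.I) *
          (Complex.exp (Complex.I * ((2 * Real.pi * inner ℝ ξ (v - w) : ℝ) : ℂ)) - 1) := by
      rw [mul_sub, mul_one, ← Complex.exp_add, inner_sub_right]
      congr 2
      push_cast
      ring
    rw [e, norm_mul, Complex.norm_exp_ofReal_mul_I, one_mul]
    refine (Real.norm_exp_I_mul_ofReal_sub_one_le).trans ?_
    have h1 := abs_real_inner_le_norm ξ (v - w)
    rw [norm_mul, Real.norm_of_nonneg (by positivity), mul_assoc _ ‖v - w‖,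
      mul_comm ‖v - w‖]
    exact mul_le_mul_of_nonneg_left h1 (by positivity)
  calc ∫ ξ, ‖ψ v ξ - ψ w ξ‖
      ≤ ∫ ξ, 2 * Real.pi * ‖v - w‖ * (‖ξ‖ * Real.exp (-(symbol α ξ) / α)) :=
        integral_mono ((hψi v).sub (hψi w)).norm (hI.const_mul _) hbd
    _ = _ := by rw [integral_const_mul]; ring

/-! ### Pointwise bounds for the stable profile -/

theorem one_sub_exp_neg_le {x : ℝ} : 1 - Real.exp (-x) ≤ x := by
  have := Real.add_one_le_exp (-x)
  linarith

theorem div_one_add_le_one_sub_exp_neg {x : ℝ} (hx : 0 ≤ x) : x / (1 + x) ≤ 1 - Real.exp (-x) := by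
  have h : Real.exp (-x) ≤ (1 + x)⁻¹ := by
    rw [Real.exp_neg]
    have := Real.add_one_le_exp x
    gcongr
    linarith
  have e : x / (1 + x) = 1 - (1 + x)⁻¹ := by field_simp; ring
  linarith

theorem abs_exp_neg_sub_exp_neg_le {x y L : ℝ} (hx : L ≤ x) (hy : L ≤ y) :
    |Real.exp (-x) - Real.exp (-y)| ≤ |x - y| * Real.exp (-L) := by
  wlog hxy : x ≤ y generalizing x y
  · rw [abs_sub_comm, abs_sub_comm x]
    exact this hy hx (le_of_not_ge hxy)
  rw [abs_of_nonneg (sub_nonneg.2 (Real.exp_le_exp.2 (neg_le_neg hxy))), abs_sub_comm,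
    abs_of_nonneg (sub_nonneg.2 hxy)]
  have e : Real.exp (-x) - Real.exp (-y) = Real.exp (-x) * (1 - Real.exp (-(y - x))) := by
    rw [mul_sub, mul_one, ← Real.exp_add]; ring_nf
  have h0 : 0 ≤ 1 - Real.exp (-(y - x)) := sub_nonneg.2 (Real.exp_le_one_iff.2 (by linarith))
  rw [e, mul_comm (y - x)]
  exact mul_le_mul (Real.exp_le_exp.2 (neg_le_neg hx)) one_sub_exp_neg_le h0 (Real.exp_pos _).le

/-- The pointwise form of the upper bounds: up to a power of `t`, a Gaussian in `t^{-1/2}` is dominated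
by a function of `t` whose mean is known from the Laplace transform. -/
theorem exists_rpow_neg_mul_exp_le {m c : ℝ} (hm : 0 ≤ m) (hc : 0 < c) :
    ∃ C : ℝ, 0 < C ∧ ∀ t : ℝ, 0 < t → t ^ (-m) * Real.exp (-(c / t)) ≤ C * (1 - Real.exp (-t)) := by
  set B : ℝ := ((m + 1) / c) ^ (m + 1) with hB
  have hB0 : 0 < B := by positivity
  refine ⟨2 * (B + 1), by positivity, fun t ht => ?_⟩
  have h1 := div_one_add_le_one_sub_exp_neg ht.le
  rcases le_total t 1 with ht1 | ht1
  · have h2 : t / 2 ≤ 1 - Real.exp (-t) :=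
      le_trans (by gcongr; linarith) h1
    -- `x ≤ e^x` at `x = c/((m+1)t)`, raised to the power `m+1`
    have h3 : t ^ (-(m + 1)) * Real.exp (-(c / t)) ≤ B := by
      have h4 : c / (m + 1) * t⁻¹ ≤ Real.exp (c / (m + 1) * t⁻¹) := by
        have := Real.add_one_le_exp (c / (m + 1) * t⁻¹)
        linarith
      have h5 := Real.rpow_le_rpow (by positivity) h4 (by linarith : 0 ≤ m + 1)
      rw [← Real.exp_mul, Real.mul_rpow (by positivity) (by positivity), Real.inv_rpow ht.le,
        ← Real.rpow_neg ht.le] at h5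
      have e1 : c / (m + 1) * t⁻¹ * (m + 1) = c / t := by field_simp
      have e2 : (c / (m + 1)) ^ (m + 1) = B⁻¹ := by
        rw [hB, ← Real.inv_rpow (by positivity), inv_div]
      rw [e1, e2] at h5
      have h6 : t ^ (-(m + 1)) ≤ B * Real.exp (c / t) := by
        rwa [inv_mul_le_iff₀ hB0] at h5
      rw [Real.exp_neg, ← div_eq_mul_inv, div_le_iff₀ (Real.exp_pos _)]
      exact h6
    have e3 : t ^ (-m) = t ^ (-(m + 1)) * t := by
      rw [← Real.rpow_add_one ht.ne']; ring_nf
    calc t ^ (-m) * Real.exp (-(c / t)) = (t ^ (-(m + 1)) * Real.exp (-(c / t))) * t := by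
          rw [e3]; ring
      _ ≤ B * t := by gcongr
      _ ≤ 2 * (B + 1) * (t / 2) := by nlinarith
      _ ≤ _ := by gcongr
  · have h2 : 1 / 2 ≤ 1 - Real.exp (-t) := by
      refine le_trans ?_ h1
      rw [div_le_div_iff₀ (by norm_num) (by positivity)]
      linarith
    have h3 : t ^ (-m) ≤ 1 := Real.rpow_le_one_of_one_le_of_nonpos ht1 (by linarith)
    have h4 : Real.exp (-(c / t)) ≤ 1 := Real.exp_le_one_iff.2 (neg_nonpos.2 (by positivity))
    calc t ^ (-m) * Real.exp (-(c / t)) ≤ 1 * 1 := by gcongr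
      _ ≤ 2 * (B + 1) * (1 / 2) := by linarith
      _ ≤ _ := by gcongr

/-- A combination of exponentials bounded by the indicator of `[1/M, M]`. -/
theorem one_sub_exp_combination_le {M y : ℝ} (hM : 1 ≤ M) (hy : 0 < y) :
    (1 - Real.exp (-y)) - 2 / M * (1 - Real.exp (-(M * y))) - 2 * (1 - Real.exp (-(y / M)))
      ≤ (Set.Icc (1 / M) M).indicator 1 y := by
  have hM0 : 0 < M := by linarith
  have hb (x : ℝ) (hx : 0 ≤ x) : 0 ≤ 1 - Real.exp (-x) := by
    rw [sub_nonneg]; exact Real.exp_le_one_iff.2 (by linarith)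
  have h1 := hb (M * y) (by positivity)
  have h2 := hb (y / M) (by positivity)
  have h1' : 0 ≤ 2 / M * (1 - Real.exp (-(M * y))) := by positivity
  by_cases hmem : y ∈ Set.Icc (1 / M) M
  · rw [Set.indicator_of_mem hmem, Pi.one_apply]
    have := Real.exp_pos (-y)
    linarith
  · rw [Set.indicator_of_notMem hmem]
    rw [Set.mem_Icc, not_and_or, not_le, not_le] at hmem
    rcases hmem with hlt | hlt
    · have h3 := div_one_add_le_one_sub_exp_neg (x := M * y) (by positivity)
      have h4 : M * y < 1 := by rwa [lt_div_iff₀' hM0] at hlt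
      have h5 : M * y / 2 ≤ 1 - Real.exp (-(M * y)) := le_trans (by gcongr; linarith) h3
      have h6 : y ≤ 2 / M * (1 - Real.exp (-(M * y))) := by
        calc y = 2 / M * (M * y / 2) := by field_simp
          _ ≤ _ := by gcongr
      have := one_sub_exp_neg_le (x := y)
      linarith
    · have h3 := div_one_add_le_one_sub_exp_neg (x := y / M) (by positivity)
      have h4 : 1 ≤ y / M := by rw [le_div_iff₀ hM0]; linarith
      have h5 : 1 / 2 ≤ y / M / (1 + y / M) := by
        rw [div_le_div_iff₀ (by norm_num) (by positivity)]
        linarith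
      have := Real.exp_pos (-y)
      linarith

section Subordinator

variable {ν : Measure ℝ} [IsProbabilityMeasure ν] {α : ℝ}

theorem integrable_exp_neg_mul (hν0 : ∀ᵐ t ∂ν, 0 < t) {s : ℝ} (hs : 0 ≤ s) :
    Integrable (fun t => Real.exp (-(s * t))) ν := by
  refine Integrable.of_bound (by fun_prop) 1 ?_
  filter_upwards [hν0] with t ht
  rw [Real.norm_of_nonneg (Real.exp_pos _).le]
  exact Real.exp_le_one_iff.2 (neg_nonpos.2 (by positivity))

theorem integrable_one_sub_exp_neg_mul (hν0 : ∀ᵐ t ∂ν, 0 < t) {s : ℝ} (hs : 0 ≤ s) :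
    Integrable (fun t => 1 - Real.exp (-(s * t))) ν :=
  (integrable_const 1).sub (integrable_exp_neg_mul hν0 hs)

theorem integral_one_sub_exp_neg_mul (hν0 : ∀ᵐ t ∂ν, 0 < t)
    (hνL : ∀ s, 0 ≤ s → ∫ t, Real.exp (-(s * t)) ∂ν = Real.exp (-s ^ (α / 2) / α))
    {s : ℝ} (hs : 0 ≤ s) :
    ∫ t, (1 - Real.exp (-(s * t))) ∂ν = 1 - Real.exp (-(s ^ (α / 2) / α)) := by
  rw [integral_sub (integrable_const 1) (integrable_exp_neg_mul hν0 hs), hνL s hs, neg_div]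
  simp

/-- The inequality of `exists_rpow_neg_mul_exp_le` at `t / r²`, integrated: with `m = d/2` it bounds the
stable profile, with `m = d/2 + 1` its gradient. -/
theorem exists_integral_rpow_neg_mul_exp_le (hα : 0 < α) (hν0 : ∀ᵐ t ∂ν, 0 < t)
    (hνL : ∀ s, 0 ≤ s → ∫ t, Real.exp (-(s * t)) ∂ν = Real.exp (-s ^ (α / 2) / α))
    {m c : ℝ} (hm : 0 ≤ m) (hc : 0 < c) :
    ∃ C : ℝ, 0 < C ∧ ∀ r : ℝ, 0 < r →
      Integrable (fun t => t ^ (-m) * Real.exp (-(c * r ^ 2 / t))) ν ∧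
      ∫ t, t ^ (-m) * Real.exp (-(c * r ^ 2 / t)) ∂ν ≤ C * r ^ (-(2 * m + α)) := by
  obtain ⟨C, hC, hle⟩ := exists_rpow_neg_mul_exp_le hm hc
  refine ⟨C / α, by positivity, fun r hr => ?_⟩
  have hs : 0 ≤ (r ^ 2)⁻¹ := by positivity
  have hI := integrable_one_sub_exp_neg_mul hν0 hs
  have hpt : ∀ᵐ t ∂ν, t ^ (-m) * Real.exp (-(c * r ^ 2 / t)) ≤
      C * r ^ (-(2 * m)) * (1 - Real.exp (-((r ^ 2)⁻¹ * t))) := by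
    filter_upwards [hν0] with t ht
    have h := hle ((r ^ 2)⁻¹ * t) (by positivity)
    have e1 : ((r ^ 2)⁻¹ * t) ^ (-m) = r ^ (2 * m) * t ^ (-m) := by
      rw [Real.mul_rpow hs ht.le, Real.inv_rpow (by positivity), Real.rpow_neg (by positivity),
        inv_inv, ← Real.rpow_natCast, ← Real.rpow_mul hr.le]
      norm_num
    have e2 : c / ((r ^ 2)⁻¹ * t) = c * r ^ 2 / t := by field_simp
    rw [e1, e2] at h
    have e3 : r ^ (-(2 * m)) * r ^ (2 * m) = 1 := by
      rw [← Real.rpow_add hr]; simp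
    calc t ^ (-m) * Real.exp (-(c * r ^ 2 / t))
        = r ^ (-(2 * m)) * (r ^ (2 * m) * t ^ (-m) * Real.exp (-(c * r ^ 2 / t))) := by
          rw [← mul_assoc, ← mul_assoc, e3, one_mul]
      _ ≤ r ^ (-(2 * m)) * (C * (1 - Real.exp (-((r ^ 2)⁻¹ * t)))) := by gcongr
      _ = _ := by ring
  have hint : Integrable (fun t => t ^ (-m) * Real.exp (-(c * r ^ 2 / t))) ν := by
    refine (hI.const_mul (C * r ^ (-(2 * m)))).mono' ?_ ?_
    · exact Measurable.aestronglyMeasurable (by fun_prop)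
    · filter_upwards [hν0, hpt] with t ht h
      rwa [Real.norm_of_nonneg (by positivity)]
  refine ⟨hint, ?_⟩
  have e4 : ((r ^ 2)⁻¹) ^ (α / 2) = r ^ (-α) := by
    rw [Real.inv_rpow (by positivity), ← Real.rpow_natCast, ← Real.rpow_mul hr.le,
      ← Real.rpow_neg hr.le]
    congr 2; push_cast; ring
  calc _ ≤ ∫ t, C * r ^ (-(2 * m)) * (1 - Real.exp (-((r ^ 2)⁻¹ * t))) ∂ν :=
        integral_mono_ae hint (hI.const_mul _) hpt
    _ = C * r ^ (-(2 * m)) * (1 - Real.exp (-(r ^ (-α) / α))) := by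
        rw [integral_const_mul, integral_one_sub_exp_neg_mul hν0 hνL hs, e4]
    _ ≤ C * r ^ (-(2 * m)) * (r ^ (-α) / α) := by
        gcongr
        exact one_sub_exp_neg_le
    _ = C / α * r ^ (-(2 * m + α)) := by
        rw [neg_add, Real.rpow_add hr]; ring

/-- For large `M` the mass of `[r²/M, r²M]` is at least of order `r^{-α}`, uniformly in `r ≥ 1`. -/
theorem exists_le_measureReal_Icc (hα₀ : 0 < α) (hα₂ : α < 2) (hν0 : ∀ᵐ t ∂ν, 0 < t)
    (hνL : ∀ s, 0 ≤ s → ∫ t, Real.exp (-(s * t)) ∂ν = Real.exp (-s ^ (α / 2) / α)) :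
    ∃ M c : ℝ, 1 ≤ M ∧ 0 < c ∧ ∀ r : ℝ, 1 ≤ r →
      c * r ^ (-α) ≤ ν.real (Set.Icc (r ^ 2 / M) (r ^ 2 * M)) := by
  set κ : ℝ := 1 / (α + 1) with hκ
  have hκ0 : 0 < κ := by positivity
  obtain ⟨M, hM1, hM⟩ : ∃ M : ℝ, 1 ≤ M ∧
      2 / α * M ^ (-(1 - α / 2)) + 2 / α * M ^ (-(α / 2)) ≤ κ / 2 := by
    have h1 := ((tendsto_rpow_neg_atTop (by linarith : 0 < 1 - α / 2)).const_mul (2 / α)).add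
      ((tendsto_rpow_neg_atTop (by positivity : 0 < α / 2)).const_mul (2 / α))
    simp only [mul_zero, add_zero] at h1
    obtain ⟨M, h2, h3⟩ := ((eventually_ge_atTop (1 : ℝ)).and
      (h1.eventually_le_const (by positivity : 0 < κ / 2))).exists
    exact ⟨M, h2, h3⟩
  have hM0 : 0 < M := by linarith
  refine ⟨M, κ / 2, hM1, by positivity, fun r hr => ?_⟩
  have hr0 : 0 < r := by linarith
  set s : ℝ := (r ^ 2)⁻¹ with hs
  have hs0 : 0 < s := by positivity
  have es : s ^ (α / 2) = r ^ (-α) := by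
    rw [hs, Real.inv_rpow (by positivity), ← Real.rpow_natCast, ← Real.rpow_mul hr0.le,
      ← Real.rpow_neg hr0.le]
    congr 2; push_cast; ring
  set q : ℝ := r ^ (-α) with hq
  have hq0 : 0 < q := by positivity
  have hq1 : q ≤ 1 := Real.rpow_le_one_of_one_le_of_nonpos hr (by linarith)
  have I1 := integrable_one_sub_exp_neg_mul hν0 hs0.le
  have I2 := (integrable_one_sub_exp_neg_mul hν0 (by positivity : 0 ≤ M * s)).const_mul (2 / M)
  have I3 := (integrable_one_sub_exp_neg_mul hν0 (by positivity : 0 ≤ s / M)).const_mul 2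
  have hpt : ∀ᵐ t ∂ν, (1 - Real.exp (-(s * t))) - 2 / M * (1 - Real.exp (-(M * s * t)))
      - 2 * (1 - Real.exp (-(s / M * t))) ≤
      (Set.Icc (r ^ 2 / M) (r ^ 2 * M)).indicator 1 t := by
    filter_upwards [hν0] with t ht
    have h := one_sub_exp_combination_le hM1 (mul_pos hs0 ht)
    have e1 : M * (s * t) = M * s * t := by ring
    have e2 : s * t / M = s / M * t := by ring
    rw [e1, e2] at h
    refine h.trans (le_of_eq ?_)
    have e3 : s * t ∈ Set.Icc (1 / M) M ↔ t ∈ Set.Icc (r ^ 2 / M) (r ^ 2 * M) := by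
      have hst : s * t = t / r ^ 2 := by rw [hs]; field_simp
      rw [Set.mem_Icc, Set.mem_Icc, hst, le_div_iff₀ (by positivity), div_le_iff₀ (by positivity),
        one_div_mul_eq_div, mul_comm M]
    by_cases h' : t ∈ Set.Icc (r ^ 2 / M) (r ^ 2 * M)
    · rw [Set.indicator_of_mem h', Set.indicator_of_mem (e3.2 h')]; rfl
    · rw [Set.indicator_of_notMem h', Set.indicator_of_notMem (fun h'' => h' (e3.1 h''))]
  have hle := integral_mono_ae ((I1.sub I2).sub I3)
    ((integrable_const 1).indicator measurableSet_Icc) hpt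
  rw [integral_indicator_one measurableSet_Icc] at hle
  have e : ∫ t, (1 - Real.exp (-(s * t))) - 2 / M * (1 - Real.exp (-(M * s * t)))
      - 2 * (1 - Real.exp (-(s / M * t))) ∂ν =
      (1 - Real.exp (-(q / α))) - 2 / M * (1 - Real.exp (-((M * s) ^ (α / 2) / α)))
      - 2 * (1 - Real.exp (-((s / M) ^ (α / 2) / α))) := by
    have I12 : Integrable (fun t => (1 - Real.exp (-(s * t)))
      - 2 / M * (1 - Real.exp (-(M * s * t)))) ν := I1.sub I2
    rw [integral_sub I12 I3, integral_sub I1 I2, integral_const_mul, integral_const_mul,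
      integral_one_sub_exp_neg_mul hν0 hνL hs0.le,
      integral_one_sub_exp_neg_mul hν0 hνL (by positivity),
      integral_one_sub_exp_neg_mul hν0 hνL (by positivity), es]
  have h1 : κ * q ≤ 1 - Real.exp (-(q / α)) := by
    refine le_trans ?_ (div_one_add_le_one_sub_exp_neg (by positivity))
    have e1 : q / α / (1 + q / α) = 1 / (α + q) * q := by field_simp
    rw [e1, hκ]
    gcongr
  have h2 : 2 / M * (1 - Real.exp (-((M * s) ^ (α / 2) / α))) ≤
      2 / α * M ^ (-(1 - α / 2)) * q := by
    have e1 : (M * s) ^ (α / 2) = M ^ (α / 2) * q := by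
      rw [Real.mul_rpow hM0.le hs0.le, es]
    have e2 : M ^ (-(1 - α / 2)) = M ^ (α / 2) / M := by
      rw [← Real.rpow_sub_one hM0.ne']; ring_nf
    calc _ ≤ 2 / M * ((M * s) ^ (α / 2) / α) := by gcongr; exact one_sub_exp_neg_le
      _ = _ := by rw [e1, e2]; field_simp
  have h3 : 2 * (1 - Real.exp (-((s / M) ^ (α / 2) / α))) ≤ 2 / α * M ^ (-(α / 2)) * q := by
    have e1 : (s / M) ^ (α / 2) = M ^ (-(α / 2)) * q := by
      rw [Real.div_rpow hs0.le hM0.le, es, Real.rpow_neg hM0.le]; ring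
    calc _ ≤ 2 * ((s / M) ^ (α / 2) / α) := by gcongr; exact one_sub_exp_neg_le
      _ = _ := by rw [e1]; ring
  have h4 : (2 / α * M ^ (-(1 - α / 2)) + 2 / α * M ^ (-(α / 2))) * q ≤ κ / 2 * q := by gcongr
  refine le_trans ?_ hle
  refine le_trans ?_ (le_of_eq e.symm)
  linarith

end Subordinator

/-- The function `ρ` is comparable to `(1+|v|)^{-K}`, and it varies by at most the relative amount
`A |v - w|` between points at distance at most one. The comparison is written as separate bounds near
the origin and at infinity, all with the constant `A`. -/
structure HasStableBounds {d : ℕ} (K A : ℝ) (ρ : Vel d → ℝ) : Prop where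
  pos : 0 < A
  le : ∀ v, ρ v ≤ A
  mul_rpow_le : ∀ v, ρ v * ‖v‖ ^ K ≤ A
  inv_le : ∀ v, ‖v‖ ≤ 1 → A⁻¹ ≤ ρ v
  inv_le_mul_rpow : ∀ v, 1 ≤ ‖v‖ → A⁻¹ ≤ ρ v * ‖v‖ ^ K
  abs_sub_le : ∀ v w, ‖v - w‖ ≤ 1 → |ρ v - ρ w| ≤ A * ‖v - w‖ * ρ w

/-- The stable profile is of exact order `|v|^{-d-α}` at infinity, and its logarithm is Lipschitz at
unit scale. -/
theorem exists_hasStableBounds_stableProfile {d : ℕ} (hd : 1 ≤ d) {α : ℝ} (hα₀ : 0 < α)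
    (hα₂ : α < 2) : ∃ A : ℝ, HasStableBounds ((d : ℝ) + α) A (stableProfile d α) := by
  obtain ⟨ν, hν, hν0, hνL, hP⟩ := exists_stableProfile_eq_integral_heatKernel hd hα₀ hα₂
  set K : ℝ := (d : ℝ) + α with hK
  have hKpos : 0 < K := by positivity
  set p : ℝ := (4 * Real.pi) ^ (-(d : ℝ) / 2) with hp
  have hp0 : 0 < p := by positivity
  have hker {t : ℝ} (ht : 0 < t) (r : ℝ) :
      heatKernel d t r = p * (t ^ (-((d : ℝ) / 2)) * Real.exp (-(1 / 4 * r ^ 2 / t))) := by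
    have e : r ^ 2 / (4 * t) = 1 / 4 * r ^ 2 / t := by field_simp
    rw [heatKernel, Real.mul_rpow (by positivity) ht.le, e, hp, neg_div]
    ring
  -- each heat kernel decreases with the distance to the origin, hence so does the mixture
  have hanti (v w : Vel d) (h : ‖v‖ ≤ ‖w‖) : stableProfile d α w ≤ stableProfile d α v := by
    rw [(hP v).2, (hP w).2]
    refine integral_mono_ae (hP w).1 (hP v).1 ?_
    filter_upwards [hν0] with t ht
    rw [heatKernel, heatKernel]
    gcongr
  have hnonneg (v : Vel d) : 0 ≤ stableProfile d α v := by
    rw [(hP v).2]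
    exact integral_nonneg_of_ae (hν0.mono fun t ht => heatKernel_nonneg d ht _)
  -- a heat kernel is `p t^{-d/2} e^{-r²/(4t)}`: take `m = d/2`, `c = 1/4`, so that `2m + α = K`
  obtain ⟨C₁, hC₁, hup⟩ := exists_integral_rpow_neg_mul_exp_le (ν := ν) hα₀ hν0 hνL
    (m := (d : ℝ) / 2) (c := 1 / 4) (by positivity) (by norm_num)
  have hupper (v : Vel d) : stableProfile d α v * ‖v‖ ^ K ≤ p * C₁ := by
    rcases eq_or_ne v 0 with rfl | hv
    · rw [norm_zero, Real.zero_rpow hKpos.ne', mul_zero]; positivity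
    have hr : 0 < ‖v‖ := norm_pos_iff.2 hv
    have h1 : stableProfile d α v ≤ p * (C₁ * ‖v‖ ^ (-K)) := by
      have h2 := (hup ‖v‖ hr).2
      have e : 2 * ((d : ℝ) / 2) + α = K := by rw [hK]; ring
      rw [e] at h2
      rw [(hP v).2, integral_congr_ae (hν0.mono fun t ht => hker ht ‖v‖), integral_const_mul]
      gcongr
    calc _ ≤ p * (C₁ * ‖v‖ ^ (-K)) * ‖v‖ ^ K := by gcongr
      _ = p * C₁ * (‖v‖ ^ (-K) * ‖v‖ ^ K) := by ring
      _ = p * C₁ := by rw [← Real.rpow_add hr]; simp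
  -- for `t ∈ [r²/M, r²M]` the heat kernel is at least of order `r^{-d}`, and these times have mass
  -- of order `r^{-α}`
  obtain ⟨M, c₂, hM1, hc₂, hmass⟩ := exists_le_measureReal_Icc (ν := ν) hα₀ hα₂ hν0 hνL
  have hM0 : 0 < M := by linarith
  set c₃ : ℝ := p * (M ^ (-((d : ℝ) / 2)) * Real.exp (-(M / 4))) with hc₃
  have hc₃0 : 0 < c₃ := by positivity
  have hlow (r : ℝ) (hr : 1 ≤ r) (hi : Integrable (fun t => heatKernel d t r) ν) :
      c₃ * c₂ * r ^ (-K) ≤ ∫ t, heatKernel d t r ∂ν := by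
    have hr0 : 0 < r := by linarith
    set S := Set.Icc (r ^ 2 / M) (r ^ 2 * M) with hS
    have h1 : ∀ᵐ t ∂ν, S.indicator (fun _ => c₃ * r ^ (-(d : ℝ))) t ≤ heatKernel d t r := by
      filter_upwards [hν0] with t ht
      by_cases hmem : t ∈ S
      · rw [Set.indicator_of_mem hmem, hker ht, hc₃]
        have e1 : M ^ (-((d : ℝ) / 2)) * r ^ (-(d : ℝ)) = (r ^ 2 * M) ^ (-((d : ℝ) / 2)) := by
          rw [Real.mul_rpow (by positivity) hM0.le, ← Real.rpow_natCast, ← Real.rpow_mul hr0.le,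
            mul_comm]
          congr 2; push_cast; ring
        have h2 : (r ^ 2 * M) ^ (-((d : ℝ) / 2)) ≤ t ^ (-((d : ℝ) / 2)) :=
          Real.rpow_le_rpow_of_nonpos ht hmem.2 (by have := d.cast_nonneg (α := ℝ); linarith)
        have h3 : Real.exp (-(M / 4)) ≤ Real.exp (-(1 / 4 * r ^ 2 / t)) := by
          refine Real.exp_le_exp.2 (neg_le_neg ?_)
          have := (div_le_iff₀ hM0).1 hmem.1
          rw [div_le_iff₀ ht]
          linarith
        calc _ = p * ((r ^ 2 * M) ^ (-((d : ℝ) / 2)) * Real.exp (-(M / 4))) := by rw [← e1]; ring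
          _ ≤ _ := by gcongr
      · rw [Set.indicator_of_notMem hmem]
        exact heatKernel_nonneg d ht r
    have h2 := integral_mono_ae ((integrable_const _).indicator measurableSet_Icc) hi h1
    rw [integral_indicator_const _ measurableSet_Icc, smul_eq_mul] at h2
    refine le_trans ?_ h2
    have e : r ^ (-K) = r ^ (-(d : ℝ)) * r ^ (-α) := by rw [hK, neg_add, Real.rpow_add hr0]
    calc c₃ * c₂ * r ^ (-K) = c₂ * r ^ (-α) * (c₃ * r ^ (-(d : ℝ))) := by rw [e]; ring
      _ ≤ _ := by
        gcongr
        exact hmass r hr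
  have hlower (v : Vel d) (hv : 1 ≤ ‖v‖) : c₃ * c₂ ≤ stableProfile d α v * ‖v‖ ^ K := by
    have hr0 : 0 < ‖v‖ := by linarith
    have := hlow ‖v‖ hv (hP v).1
    rw [← (hP v).2] at this
    calc c₃ * c₂ = c₃ * c₂ * ‖v‖ ^ (-K) * ‖v‖ ^ K := by
          rw [mul_assoc (c₃ * c₂), ← Real.rpow_add hr0]; simp
      _ ≤ _ := by gcongr
  have hlower1 (v : Vel d) (hv : ‖v‖ ≤ 1) : c₃ * c₂ ≤ stableProfile d α v := by
    have := nontrivial_vel hd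
    obtain ⟨e, he⟩ := exists_norm_eq (Vel d) (zero_le_one (α := ℝ))
    have h1 := hlower e he.ge
    rw [he, Real.one_rpow, mul_one] at h1
    exact h1.trans (hanti v e (by rw [he]; exact hv))
  -- For `‖w‖ ≤ 2` the global Lipschitz bound suffices, the profile being bounded below there. For
  -- `‖w‖ ≥ 2` both norms are at least `‖w‖/2`, whence `c = 1/16`, and the derivative of the heat
  -- kernel brings a factor `1/t`, whence `m = d/2 + 1`.
  obtain ⟨C₄, hC₄, hlip⟩ := exists_abs_stableProfile_sub_le hd hα₀
  obtain ⟨C₅, hC₅, hder⟩ := exists_integral_rpow_neg_mul_exp_le (ν := ν) hα₀ hν0 hνL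
    (m := (d : ℝ) / 2 + 1) (c := 1 / 16) (by positivity) (by norm_num)
  have hfar (v w : Vel d) (hvw : ‖v - w‖ ≤ 1) (hw : 2 ≤ ‖w‖) :
      |stableProfile d α v - stableProfile d α w| ≤ p * C₅ * ‖v - w‖ * ‖w‖ ^ (-K) := by
    have hw0 : 0 < ‖w‖ := by linarith
    have hv1 : ‖w‖ / 2 ≤ ‖v‖ := by
      have := norm_sub_norm_le w v
      rw [norm_sub_rev] at this
      linarith
    have hv2 : ‖v‖ ≤ 2 * ‖w‖ := by
      have := norm_sub_norm_le v w
      linarith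
    have hpt : ∀ᵐ t ∂ν, ‖heatKernel d t ‖v‖ - heatKernel d t ‖w‖‖ ≤ p * ‖v - w‖ * ‖w‖ *
        (t ^ (-((d : ℝ) / 2 + 1)) * Real.exp (-(1 / 16 * ‖w‖ ^ 2 / t))) := by
      filter_upwards [hν0] with t ht
      rw [hker ht, hker ht, ← mul_sub, ← mul_sub, Real.norm_eq_abs, abs_mul, abs_mul,
        abs_of_pos hp0, abs_of_pos (by positivity : 0 < t ^ (-((d : ℝ) / 2)))]
      have h1 := abs_exp_neg_sub_exp_neg_le (x := 1 / 4 * ‖v‖ ^ 2 / t) (y := 1 / 4 * ‖w‖ ^ 2 / t)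
        (L := 1 / 16 * ‖w‖ ^ 2 / t)
        (by gcongr ?_ / t; nlinarith) (by gcongr ?_ / t; nlinarith)
      have h2 : |1 / 4 * ‖v‖ ^ 2 / t - 1 / 4 * ‖w‖ ^ 2 / t| ≤ ‖v - w‖ * ‖w‖ / t := by
        have e : 1 / 4 * ‖v‖ ^ 2 / t - 1 / 4 * ‖w‖ ^ 2 / t =
            1 / 4 * ((‖v‖ - ‖w‖) * (‖v‖ + ‖w‖)) / t := by ring
        rw [e, abs_div, abs_of_pos ht, abs_mul, abs_mul, abs_of_nonneg (by positivity : 0 ≤ ‖v‖ + ‖w‖),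
          abs_of_pos (by norm_num : (0 : ℝ) < 1 / 4)]
        have h3 := mul_le_mul (abs_norm_sub_norm_le v w)
          (by linarith : ‖v‖ + ‖w‖ ≤ 4 * ‖w‖) (by positivity) (norm_nonneg _)
        exact div_le_div_of_nonneg_right (by linarith) ht.le
      have e : t ^ (-((d : ℝ) / 2)) = t ^ (-((d : ℝ) / 2 + 1)) * t := by
        rw [← Real.rpow_add_one ht.ne']; ring_nf
      calc p * (t ^ (-((d : ℝ) / 2)) * |Real.exp (-(1 / 4 * ‖v‖ ^ 2 / t)) -
            Real.exp (-(1 / 4 * ‖w‖ ^ 2 / t))|)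
          ≤ p * (t ^ (-((d : ℝ) / 2)) * (‖v - w‖ * ‖w‖ / t *
            Real.exp (-(1 / 16 * ‖w‖ ^ 2 / t)))) := by
            gcongr
            exact h1.trans (by gcongr)
        _ = _ := by rw [e]; field_simp
    have hdw := hder ‖w‖ hw0
    rw [(hP v).2, (hP w).2, ← integral_sub (hP v).1 (hP w).1]
    refine (norm_integral_le_of_norm_le (hdw.1.const_mul _) hpt).trans ?_
    rw [integral_const_mul]
    calc _ ≤ p * ‖v - w‖ * ‖w‖ * (C₅ * ‖w‖ ^ (-(2 * ((d : ℝ) / 2 + 1) + α))) := by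
          gcongr
          exact hdw.2
      _ = p * C₅ * ‖v - w‖ * (‖w‖ ^ (-(2 * ((d : ℝ) / 2 + 1) + α)) * ‖w‖) := by ring
      _ ≤ _ := by
        rw [← Real.rpow_add_one hw0.ne']
        gcongr ?_ * ?_
        refine Real.rpow_le_rpow_of_exponent_le (by linarith) ?_
        rw [hK]; linarith
  set c₆ := c₃ * c₂ with hc₆
  have hc₆0 : 0 < c₆ := by positivity
  have hlow2 (w : Vel d) (hw : ‖w‖ ≤ 2) : c₆ * (2 : ℝ) ^ (-K) ≤ stableProfile d α w := by
    rcases le_total ‖w‖ 1 with h | h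
    · refine le_trans ?_ (hlower1 w h)
      have := Real.rpow_le_one_of_one_le_of_nonpos (by norm_num : (1 : ℝ) ≤ 2)
        (by linarith : -K ≤ 0)
      nlinarith
    · have h1 := hlower w h
      have h2 : ‖w‖ ^ K ≤ 2 ^ K := by gcongr
      have h3 : c₆ ≤ stableProfile d α w * 2 ^ K :=
        h1.trans (mul_le_mul_of_nonneg_left h2 (hnonneg w))
      rw [Real.rpow_neg (by norm_num), ← div_eq_mul_inv, div_le_iff₀ (by positivity)]
      exact h3
  set A₅ : ℝ := C₄ * 2 ^ K / c₆ + p * C₅ / c₆ with hA₅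
  have hA₅0 : 0 ≤ A₅ := by positivity
  have hlog (v w : Vel d) (hvw : ‖v - w‖ ≤ 1) :
      |stableProfile d α v - stableProfile d α w| ≤ A₅ * ‖v - w‖ * stableProfile d α w := by
    have hn := hnonneg w
    rcases le_total ‖w‖ 2 with hw | hw
    · have h1 := hlow2 w hw
      have h2 : 1 ≤ 2 ^ K / c₆ * stableProfile d α w := by
        calc 1 = 2 ^ K / c₆ * (c₆ * 2 ^ (-K)) := by
              rw [Real.rpow_neg (by norm_num)]
              field_simp
          _ ≤ _ := by gcongr
      calc _ ≤ C₄ * ‖v - w‖ * 1 := by rw [mul_one]; exact hlip v w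
        _ ≤ C₄ * ‖v - w‖ * (2 ^ K / c₆ * stableProfile d α w) := by gcongr
        _ = C₄ * 2 ^ K / c₆ * ‖v - w‖ * stableProfile d α w := by ring
        _ ≤ _ := by
          gcongr
          rw [hA₅]
          exact le_add_of_nonneg_right (by positivity)
    · have hw0 : 0 < ‖w‖ := by linarith
      have h1 := hlower w (by linarith)
      have h2 : ‖w‖ ^ (-K) ≤ 1 / c₆ * stableProfile d α w := by
        rw [Real.rpow_neg hw0.le, inv_le_iff_one_le_mul₀ (by positivity)]
        calc 1 = 1 / c₆ * c₆ := by field_simp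
          _ ≤ 1 / c₆ * (stableProfile d α w * ‖w‖ ^ K) := by gcongr
          _ = _ := by ring
      calc _ ≤ p * C₅ * ‖v - w‖ * ‖w‖ ^ (-K) := hfar v w hvw hw
        _ ≤ p * C₅ * ‖v - w‖ * (1 / c₆ * stableProfile d α w) := by gcongr
        _ = p * C₅ / c₆ * ‖v - w‖ * stableProfile d α w := by ring
        _ ≤ _ := by
          gcongr
          rw [hA₅]
          exact le_add_of_nonneg_left (by positivity)
  refine ⟨stableProfile d α 0 + p * C₁ + c₆⁻¹ + A₅, ?_, fun v => ?_, fun v => ?_, fun v hv => ?_,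
    fun v hv => ?_, fun v w hvw => ?_⟩
  · have := hnonneg 0
    positivity
  · have h1 := hanti 0 v (by simp)
    have : 0 ≤ p * C₁ + c₆⁻¹ + A₅ := by positivity
    linarith
  · have := hnonneg 0
    have : 0 ≤ c₆⁻¹ + A₅ := by positivity
    have := hupper v
    linarith
  · refine le_trans (inv_le_of_inv_le₀ hc₆0 ?_) (hlower1 v hv)
    have := hnonneg 0
    have : 0 ≤ p * C₁ := by positivity
    linarith
  · refine le_trans (inv_le_of_inv_le₀ hc₆0 ?_) (hlower v hv)
    have := hnonneg 0
    have : 0 ≤ p * C₁ := by positivity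
    linarith
  · refine (hlog v w hvw).trans ?_
    have h0 := hnonneg 0
    have h1 := hnonneg w
    have h2 : 0 ≤ p * C₁ + c₆⁻¹ := by positivity
    gcongr
    linarith

/-! ### Consequences of the bounds -/

namespace HasStableBounds

variable {d : ℕ} {K A : ℝ} {ρ : Vel d → ℝ}

theorem apply_pos (h : HasStableBounds K A ρ) (v : Vel d) : 0 < ρ v := by
  have hA := inv_pos.2 h.pos
  rcases le_total ‖v‖ 1 with hv | hv
  · exact hA.trans_le (h.inv_le v hv)
  · exact pos_of_mul_pos_left (hA.trans_le (h.inv_le_mul_rpow v hv)) (by positivity)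

theorem const_mul (h : HasStableBounds K A ρ) {c : ℝ} (hc : 0 < c) :
    HasStableBounds K (A * (c + c⁻¹ + 1)) (fun v => c * ρ v) := by
  have hA := h.pos
  have h1 : c * A ≤ A * (c + c⁻¹ + 1) := by
    have : 0 < A * (c⁻¹ + 1) := by positivity
    linarith
  have h2 : (A * (c + c⁻¹ + 1))⁻¹ ≤ c * A⁻¹ := by
    have e : c * A⁻¹ = (A * c⁻¹)⁻¹ := by rw [mul_inv, inv_inv, mul_comm]
    rw [e]
    gcongr
    linarith
  refine ⟨by positivity, fun v => ?_, fun v => ?_, fun v hv => ?_, fun v hv => ?_,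
    fun v w hvw => ?_⟩
  · exact le_trans (by gcongr; exact h.le v) h1
  · rw [mul_assoc]
    exact le_trans (by gcongr; exact h.mul_rpow_le v) h1
  · exact h2.trans (by gcongr; exact h.inv_le v hv)
  · rw [mul_assoc]
    exact h2.trans (by gcongr; exact h.inv_le_mul_rpow v hv)
  · rw [← mul_sub, abs_mul, abs_of_pos hc]
    have h3 : A ≤ A * (c + c⁻¹ + 1) := by
      have : 0 < A * (c + c⁻¹) := by positivity
      linarith
    have hw := (h.apply_pos w).le
    calc c * |ρ v - ρ w| ≤ c * (A * ‖v - w‖ * ρ w) := by gcongr; exact h.abs_sub_le v w hvw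
      _ = A * ‖v - w‖ * (c * ρ w) := by ring
      _ ≤ _ := by gcongr

theorem continuous (h : HasStableBounds K A ρ) : Continuous ρ := by
  refine continuous_iff_continuousAt.2 fun w => ?_
  refine tendsto_iff_norm_sub_tendsto_zero.2 ?_
  have h1 : Tendsto (fun v => A * ‖v - w‖ * ρ w) (𝓝 w) (𝓝 0) := by
    have : Continuous fun v => A * ‖v - w‖ * ρ w := by fun_prop
    simpa using this.tendsto w
  refine squeeze_zero' (.of_forall fun v => norm_nonneg _) ?_ h1
  filter_upwards [Metric.closedBall_mem_nhds w one_pos] with v hv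
  exact h.abs_sub_le v w (by rwa [← dist_eq_norm])

theorem integrable (h : HasStableBounds K A ρ) (hK : (d : ℝ) < K) : Integrable ρ := by
  have hK0 : 0 < K := d.cast_nonneg.trans_lt hK
  have hA := h.pos
  have hI := (integrable_one_add_norm (E := Vel d) (μ := volume) (r := K) (by simpa using hK))
  refine (hI.const_mul (2 ^ K * A)).mono' h.continuous.aestronglyMeasurable (.of_forall fun v => ?_)
  have hv := h.apply_pos v
  rw [Real.norm_of_nonneg hv.le, Real.rpow_neg (by positivity), ← div_eq_mul_inv,
    le_div_iff₀ (by positivity)]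
  rcases le_total ‖v‖ 1 with h1 | h1
  · calc ρ v * (1 + ‖v‖) ^ K ≤ A * 2 ^ K := by
          gcongr
          · exact h.le v
          · linarith
      _ = _ := mul_comm _ _
  · calc ρ v * (1 + ‖v‖) ^ K ≤ ρ v * (2 * ‖v‖) ^ K := by gcongr; linarith
      _ = 2 ^ K * (ρ v * ‖v‖ ^ K) := by rw [Real.mul_rpow (by norm_num) (norm_nonneg _)]; ring
      _ ≤ _ := by gcongr; exact h.mul_rpow_le v

/-- The weight `ρ ⊗ ρ` is dominated by the weight of the jump form. -/
theorem mul_mul_rpow_le (h : HasStableBounds K A ρ) (hK : 0 < K) (v w : Vel d) :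
    ρ v * ρ w * ‖v - w‖ ^ K ≤ 2 ^ K * A * (ρ v + ρ w) := by
  wlog hvw : ‖v‖ ≤ ‖w‖ generalizing v w
  · have := this w v (le_of_not_ge hvw)
    rw [norm_sub_rev, mul_comm (ρ v), add_comm (ρ v)]
    exact this
  have hv := h.apply_pos v
  have hw := h.apply_pos w
  have hA := h.pos
  have h1 : ‖v - w‖ ≤ 2 * ‖w‖ := (norm_sub_le v w).trans (by linarith)
  calc ρ v * ρ w * ‖v - w‖ ^ K ≤ ρ v * ρ w * (2 * ‖w‖) ^ K := by gcongr
    _ = 2 ^ K * (ρ w * ‖w‖ ^ K) * ρ v := by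
      rw [Real.mul_rpow (by norm_num) (norm_nonneg _)]; ring
    _ ≤ 2 ^ K * A * ρ v := by gcongr; exact h.mul_rpow_le w
    _ ≤ _ := by gcongr; linarith

end HasStableBounds

/-- The kernel `|z|^{2-K}` for `|z| ≤ 1`, and `|z|^{-K}` for `|z| > 1`. -/
def truncatedKernel {d : ℕ} (K : ℝ) (z : Vel d) : ℝ :=
  if ‖z‖ ≤ 1 then ‖z‖ ^ (2 - K) else ‖z‖ ^ (-K)

theorem truncatedKernel_nonneg {d : ℕ} (K : ℝ) (z : Vel d) : 0 ≤ truncatedKernel K z := by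
  unfold truncatedKernel; split_ifs <;> positivity

theorem measurable_truncatedKernel {d : ℕ} (K : ℝ) : Measurable (truncatedKernel (d := d) K) :=
  Measurable.ite (measurableSet_le measurable_norm measurable_const)
    (measurable_norm.pow_const _) (measurable_norm.pow_const _)

theorem integrable_truncatedKernel {d : ℕ} (hd : 1 ≤ d) {K : ℝ} (hK : (d : ℝ) < K)
    (hK2 : K < d + 2) : Integrable (truncatedKernel (d := d) K) := by
  have hm := (measurable_truncatedKernel (d := d) K).aestronglyMeasurable (μ := volume)
  have hK0 : 0 < K := d.cast_nonneg.trans_lt hK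
  rw [← integrableOn_univ, ← Set.union_compl_self (Metric.ball (0 : Vel d) 1)]
  refine IntegrableOn.union ?_ ?_
  · refine integrableOn_ball_of_norm_le_rpow (C := 1) (α := K - 2) ?_ ?_ ?_ hm
    · simpa using hd
    · simp only [finrank_euclideanSpace_fin]; linarith
    · filter_upwards [ae_restrict_mem measurableSet_ball] with z hz
      rw [mem_ball_zero_iff] at hz
      rw [Real.norm_of_nonneg (truncatedKernel_nonneg _ _), truncatedKernel, if_pos hz.le, one_mul,
        neg_sub]
  · have hI := (integrable_one_add_norm (E := Vel d) (μ := volume) (r := K) (by simpa using hK))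
    refine (hI.const_mul (2 ^ K)).integrableOn.mono' hm.restrict ?_
    filter_upwards [ae_restrict_mem measurableSet_ball.compl] with z hz
    rw [Set.mem_compl_iff, mem_ball_zero_iff, not_lt] at hz
    have hz0 : 0 < ‖z‖ := by linarith
    have h1 : truncatedKernel K z = ‖z‖ ^ (-K) := by
      rw [truncatedKernel]
      split_ifs with h
      · rw [le_antisymm h hz]; simp
      · rfl
    rw [Real.norm_of_nonneg (truncatedKernel_nonneg _ _), h1, Real.rpow_neg hz0.le,
      Real.rpow_neg (by positivity), ← div_eq_mul_inv, inv_le_iff_one_le_mul₀ (by positivity),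
      div_mul_eq_mul_div, le_div_iff₀ (by positivity), one_mul,
      ← Real.mul_rpow (by norm_num) hz0.le]
    gcongr
    linarith

namespace HasStableBounds

variable {d : ℕ} {K A : ℝ} {ρ : Vel d → ℝ}

/-- The jump form of `√ρ`, at a fixed point `w`, is bounded by a multiple of `ρ w`. -/
theorem sq_sqrt_sub_sqrt_div_le (h : HasStableBounds K A ρ) (hK : 0 < K) (v w : Vel d) :
    (√(ρ v) - √(ρ w)) ^ 2 / ‖v - w‖ ^ K ≤
      (1 + A + A ^ 2 + 2 ^ K * A + 2 ^ K * A ^ 2) * ρ w * (truncatedKernel K (v - w) + ρ v) := by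
  have hA := h.pos
  have hv := h.apply_pos v
  have hw := h.apply_pos w
  set C : ℝ := 1 + A + A ^ 2 + 2 ^ K * A + 2 ^ K * A ^ 2 with hC
  have p1 : 0 < 2 ^ K * A := by positivity
  have p2 : 0 < 2 ^ K * A ^ 2 := by positivity
  have p3 : 0 < A ^ 2 := by positivity
  have hC0 : 0 < C := by positivity
  have hk0 := truncatedKernel_nonneg K (v - w)
  rcases eq_or_ne v w with rfl | hne
  · simp only [sub_self]
    simp only [sub_self] at hk0
    have : (0 : ℝ) ^ 2 / ‖(0 : Vel d)‖ ^ K = 0 := by simp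
    rw [this]
    positivity
  have hz : 0 < ‖v - w‖ := norm_pos_iff.2 (sub_ne_zero.2 hne)
  have sv := Real.sqrt_nonneg (ρ v)
  have sw := Real.sqrt_nonneg (ρ w)
  have ev := Real.sq_sqrt hv.le
  have ew := Real.sq_sqrt hw.le
  rcases le_or_gt ‖v - w‖ 1 with hz1 | hz1
  · have hk : truncatedKernel K (v - w) = ‖v - w‖ ^ 2 / ‖v - w‖ ^ K := by
      rw [truncatedKernel, if_pos hz1, Real.rpow_sub hz, Real.rpow_two]
    have h1 : (√(ρ v) - √(ρ w)) ^ 2 ≤ A ^ 2 * ‖v - w‖ ^ 2 * ρ w := by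
      -- `(√a - √b)² b ≤ (a - b)²`
      have h2 : (√(ρ v) - √(ρ w)) ^ 2 * ρ w ≤ (ρ v - ρ w) ^ 2 := by
        have e : (ρ v - ρ w) ^ 2 = (√(ρ v) - √(ρ w)) ^ 2 * (√(ρ v) + √(ρ w)) ^ 2 := by
          rw [← mul_pow]; congr 1; nlinarith
        rw [e]
        gcongr
        nlinarith [mul_nonneg sv sw]
      have h3 : (ρ v - ρ w) ^ 2 ≤ (A * ‖v - w‖ * ρ w) ^ 2 := by
        rw [← sq_abs]
        gcongr
        exact h.abs_sub_le v w hz1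
      have h4 : (√(ρ v) - √(ρ w)) ^ 2 * ρ w ≤ A ^ 2 * ‖v - w‖ ^ 2 * ρ w * ρ w :=
        (h2.trans h3).trans (le_of_eq (by ring))
      exact le_of_mul_le_mul_right h4 hw
    calc (√(ρ v) - √(ρ w)) ^ 2 / ‖v - w‖ ^ K ≤ A ^ 2 * ‖v - w‖ ^ 2 * ρ w / ‖v - w‖ ^ K := by gcongr
      _ = A ^ 2 * ρ w * truncatedKernel K (v - w) := by rw [hk]; ring
      _ ≤ C * ρ w * (truncatedKernel K (v - w) + ρ v) := by
        gcongr
        · rw [hC]; linarith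
        · linarith
  · have hk : truncatedKernel K (v - w) = (‖v - w‖ ^ K)⁻¹ := by
      rw [truncatedKernel, if_neg (not_le.2 hz1), Real.rpow_neg hz.le]
    have hk1 : (‖v - w‖ ^ K)⁻¹ ≤ 1 :=
      inv_le_one_of_one_le₀ (Real.one_le_rpow hz1.le hK.le)
    set k := truncatedKernel K (v - w) with hkdef
    have h1 : (√(ρ v) - √(ρ w)) ^ 2 ≤ ρ v + ρ w := by nlinarith [mul_nonneg sv sw]
    have h2 : ρ v * k ≤ (A + 2 ^ K * A + 2 ^ K * A ^ 2) * ρ w * (k + ρ v) := by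
      have hρk : 0 ≤ ρ w * k := by positivity
      have hρρ : 0 ≤ ρ w * ρ v := by positivity
      rcases le_total ‖w‖ 1 with hw1 | hw1
      · have h3 : 1 ≤ A * ρ w := by
          have := h.inv_le w hw1
          rwa [inv_le_iff_one_le_mul₀' hA] at this
        calc ρ v * k ≤ ρ v * 1 := by gcongr; rw [hk]; exact hk1
          _ ≤ ρ v * (A * ρ w) := by gcongr
          _ = A * ρ w * ρ v := by ring
          _ ≤ _ := by
            gcongr
            · linarith
            · linarith
      · have hw0 : 0 < ‖w‖ := by linarith
        have h3 : (‖w‖ ^ K)⁻¹ ≤ A * ρ w := by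
          have := h.inv_le_mul_rpow w hw1
          rw [inv_le_iff_one_le_mul₀ (by positivity)]
          rw [inv_le_iff_one_le_mul₀' hA] at this
          linarith
        have h4 {x : ℝ} (hx : ‖w‖ / 2 ≤ x) : (x ^ K)⁻¹ ≤ 2 ^ K * (A * ρ w) := by
          have hx0 : 0 < x := by linarith
          calc (x ^ K)⁻¹ ≤ ((‖w‖ / 2) ^ K)⁻¹ := by gcongr
            _ = 2 ^ K * (‖w‖ ^ K)⁻¹ := by
              rw [Real.div_rpow hw0.le (by norm_num), inv_div, div_eq_mul_inv]
            _ ≤ _ := by gcongr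
        rcases le_or_gt (‖w‖ / 2) ‖v - w‖ with h5 | h5
        · calc ρ v * k ≤ ρ v * (2 ^ K * (A * ρ w)) := by gcongr; rw [hk]; exact h4 h5
            _ = 2 ^ K * A * ρ w * ρ v := by ring
            _ ≤ _ := by
              gcongr
              · linarith
              · linarith
        · have h6 : ‖w‖ / 2 ≤ ‖v‖ := by
            have := norm_sub_norm_le w v
            rw [norm_sub_rev] at this
            linarith
          have hv0 : 0 < ‖v‖ := by linarith
          have h7 : ρ v ≤ A * (‖v‖ ^ K)⁻¹ := by
            rw [← div_eq_mul_inv, le_div_iff₀ (by positivity)]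
            exact h.mul_rpow_le v
          calc ρ v * k ≤ (A * (2 ^ K * (A * ρ w))) * k := by
                gcongr
                exact h7.trans (by gcongr; exact h4 h6)
            _ = 2 ^ K * A ^ 2 * ρ w * k := by ring
            _ ≤ _ := by
              gcongr
              · linarith
              · linarith
    have h8 : ρ w * k ≤ (1 + A ^ 2) * ρ w * (k + ρ v) := by
      have h9 : 0 ≤ ρ w * ρ v + A ^ 2 * ρ w * (k + ρ v) := by positivity
      linarith
    calc (√(ρ v) - √(ρ w)) ^ 2 / ‖v - w‖ ^ K ≤ (ρ v + ρ w) / ‖v - w‖ ^ K := by gcongr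
      _ = ρ v * k + ρ w * k := by rw [hk]; ring
      _ ≤ _ := add_le_add h2 h8
      _ = _ := by rw [hC]; ring

end HasStableBounds

/-! ### The Fourier transform of a translate and the Gagliardo seminorm -/

/-- Translation multiplies the `L²` Fourier transform by a character. -/
theorem fourier_translate {d : ℕ} (a : Vel d) (G : L2 d) :
    ∀ᵐ ξ ∂(volume : Measure (Vel d)),
      (𝓕 (Lp.compMeasurePreserving (· - a) (measurePreserving_sub_right volume a) G) : L2 d) ξ
        = (Real.fourierChar (-inner ℝ a ξ) : ℂ) * (𝓕 G : L2 d) ξ := by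
  have hm : MemLp (fun ξ : Vel d => (Real.fourierChar (-inner ℝ a ξ) : ℂ)) ∞ volume := by
    refine memLp_top_of_bound ?_ 1 (.of_forall fun ξ => (Circle.norm_coe _).le)
    exact Continuous.aestronglyMeasurable
      (continuous_subtype_val.comp (Real.continuous_fourierChar.comp (by fun_prop)))
  let M : L2 d →L[ℂ] L2 d := (ContinuousLinearMap.mul ℂ ℂ).holderL volume ∞ 2 2 (hm.toLp _)
  have hM (H : L2 d) : ∀ᵐ ξ, M H ξ = (Real.fourierChar (-inner ℝ a ξ) : ℂ) * H ξ := by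
    filter_upwards [(ContinuousLinearMap.mul ℂ ℂ).coeFn_holder (r := 2) (hm.toLp _) H,
      hm.coeFn_toLp] with ξ h1 h2
    simp [M, h1, h2]
  have key : (𝓕 (Lp.compMeasurePreserving (· - a) (measurePreserving_sub_right volume a) G) : L2 d)
      = M (𝓕 G) := by
    refine DenseRange.induction_on
      (p := fun G : L2 d => (𝓕 (Lp.compMeasurePreserving (· - a)
        (measurePreserving_sub_right volume a) G) : L2 d) = M (𝓕 G))
      (SchwartzMap.denseRange_toLpCLM (p := 2) ENNReal.ofNat_ne_top) G ?_ ?_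
    · refine isClosed_eq ?_ (M.continuous.comp (Lp.fourierTransformₗᵢ (Vel d) ℂ).continuous)
      exact (Lp.fourierTransformₗᵢ (Vel d) ℂ).continuous.comp
        (Lp.isometry_compMeasurePreserving _).continuous
    · intro φ
      have h1 : Lp.compMeasurePreserving (· - a) (measurePreserving_sub_right volume a)
          (toLpCLM ℝ ℂ 2 volume φ) = (φ.compSubConstCLM ℂ a).toLp 2 := rfl
      have h2 : (toLpCLM ℝ ℂ 2 volume φ : L2 d) = φ.toLp 2 := rfl
      rw [h1, h2, toLp_fourier_eq, toLp_fourier_eq]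
      refine Lp.ext ?_
      filter_upwards [hM ((𝓕 φ).toLp 2), (𝓕 φ).coeFn_toLp 2 volume,
        (𝓕 (φ.compSubConstCLM ℂ a)).coeFn_toLp 2 volume] with ξ e1 e2 e3
      rw [e1, e2, e3, SchwartzMap.fourier_coe, SchwartzMap.fourier_coe]
      have := congrFun (VectorFourier.fourierIntegral_comp_add_right Real.fourierChar
        (volume : Measure (Vel d)) (innerₗ (Vel d)) (φ : Vel d → ℂ) (-a)) ξ
      simp only [map_neg, LinearMap.neg_apply, innerₗ_apply_apply] at this
      exact this
  rw [key]
  exact hM _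

theorem lintegral_enorm_sq_eq {d : ℕ} (H : L2 d) :
    ∫⁻ v, ‖H v‖ₑ ^ 2 = ENNReal.ofReal (‖H‖ ^ 2) := by
  rw [ENNReal.ofReal_pow (norm_nonneg _), ofReal_norm, Lp.enorm_def,
    eLpNorm_eq_lintegral_rpow_enorm_toReal (by norm_num) (by norm_num)]
  rw [← ENNReal.rpow_natCast, ← ENNReal.rpow_mul]
  simp

/-- Plancherel's identity for the differences `G(· - a) - G`. -/
theorem lintegral_translate_sub {d : ℕ} (a : Vel d) (G : L2 d) :
    ∫⁻ v, ‖G (v - a) - G v‖ₑ ^ 2 =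
      ∫⁻ ξ, ‖(Real.fourierChar (-inner ℝ a ξ) : ℂ) - 1‖ₑ ^ 2 * ‖(𝓕 G : L2 d) ξ‖ₑ ^ 2 := by
  set T : L2 d := Lp.compMeasurePreserving (· - a) (measurePreserving_sub_right volume a) G
  have h1 : ∫⁻ v, ‖G (v - a) - G v‖ₑ ^ 2 = ∫⁻ v, ‖(T - G) v‖ₑ ^ 2 := by
    refine lintegral_congr_ae ?_
    filter_upwards [Lp.coeFn_sub T G,
      Lp.coeFn_compMeasurePreserving G (measurePreserving_sub_right volume a)] with v e1 e2
    rw [e1, Pi.sub_apply, e2]; rfl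
  rw [h1, lintegral_enorm_sq_eq, ← Lp.norm_fourier_eq, ← lintegral_enorm_sq_eq]
  refine lintegral_congr_ae ?_
  have h2 : (𝓕 (T - G) : L2 d) = 𝓕 T - 𝓕 G := (Lp.fourierTransformₗᵢ (Vel d) ℂ).map_sub T G
  rw [h2]
  filter_upwards [fourier_translate a G, Lp.coeFn_sub (𝓕 T : L2 d) (𝓕 G)] with ξ e1 e2
  rw [e2, Pi.sub_apply, e1, ← mul_pow, ← enorm_mul, sub_mul, one_mul]

/-- The symbol of the Gagliardo seminorm is bounded below by `|ξ|^α`: on the ball of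
centre `ξ/(4|ξ|²)` and radius `1/(8|ξ|)` the product `z·ξ` lies between `1/8` and `3/8`. -/
theorem exists_symbol_sq_le (d : ℕ) (hd : 1 ≤ d) {α : ℝ} (hα : 0 < α) :
    ∃ C : ℝ, 0 < C ∧ ∀ ξ : Vel d, ENNReal.ofReal (symbol (α / 2) ξ ^ 2) ≤ ENNReal.ofReal C *
      ∫⁻ z : Vel d, ‖(Real.fourierChar (-inner ℝ z ξ) : ℂ) - 1‖ₑ ^ 2
        * ENNReal.ofReal (‖z‖ ^ ((d : ℝ) + α))⁻¹ := by
  have : Nonempty (Fin d) := ⟨⟨0, hd⟩⟩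
  set b : ℝ := volume.real (Metric.ball (0 : Vel d) 1) with hb
  have hb0 : 0 < b := by
    rw [hb, Measure.real]
    exact ENNReal.toReal_pos (Metric.measure_ball_pos _ _ one_pos).ne' measure_ball_lt_top.ne
  set K : ℝ := (d : ℝ) + α with hK
  have hKpos : 0 < K := by positivity
  set c : ℝ := (1 / 4) * ((3 / 8) ^ K)⁻¹ * ((1 / 8) ^ d * b) with hc
  have hc0 : 0 < c := by positivity
  refine ⟨(2 * Real.pi) ^ α / c, by positivity, fun ξ => ?_⟩
  rcases eq_or_ne ξ 0 with rfl | hξ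
  · have : symbol (α / 2) (0 : Vel d) = 0 := by
      simp [symbol, Real.zero_rpow (by positivity : α / 2 ≠ 0)]
    simp [this]
  have hn : 0 < ‖ξ‖ := norm_pos_iff.2 hξ
  set B := Metric.ball ((1 / (4 * ‖ξ‖ ^ 2)) • ξ) (1 / (8 * ‖ξ‖)) with hB
  have hvol : volume B = ENNReal.ofReal ((1 / (8 * ‖ξ‖)) ^ d * b) := by
    rw [hB, Measure.addHaar_ball volume _ (by positivity), ENNReal.ofReal_mul (by positivity), hb,
      Measure.real, ENNReal.ofReal_toReal measure_ball_lt_top.ne]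
    simp
  have hpt : ∀ z ∈ B, ENNReal.ofReal ((1 / 4) * ((3 / (8 * ‖ξ‖)) ^ K)⁻¹) ≤
      ‖(Real.fourierChar (-inner ℝ z ξ) : ℂ) - 1‖ₑ ^ 2 * ENNReal.ofReal (‖z‖ ^ K)⁻¹ := by
    intro z hz
    rw [hB, mem_ball_iff_norm] at hz
    have h0 : ‖(1 / (4 * ‖ξ‖ ^ 2)) • ξ‖ = 1 / (4 * ‖ξ‖) := by
      rw [norm_smul, Real.norm_of_nonneg (by positivity)]; field_simp
    have hz1 : ‖z‖ ≤ 3 / (8 * ‖ξ‖) := by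
      have := norm_le_norm_add_norm_sub ((1 / (4 * ‖ξ‖ ^ 2)) • ξ) z
      rw [h0, norm_sub_rev] at this
      have e : 3 / (8 * ‖ξ‖) = 1 / (4 * ‖ξ‖) + 1 / (8 * ‖ξ‖) := by field_simp; norm_num
      linarith
    have hin : |inner ℝ z ξ - 1 / 4| ≤ 1 / 8 := by
      have e1 : inner ℝ z ξ - 1 / 4 = inner ℝ (z - (1 / (4 * ‖ξ‖ ^ 2)) • ξ) ξ := by
        rw [inner_sub_left, real_inner_smul_left, real_inner_self_eq_norm_sq]; field_simp
      rw [e1]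
      refine (abs_real_inner_le_norm _ _).trans ?_
      calc _ ≤ 1 / (8 * ‖ξ‖) * ‖ξ‖ := by gcongr
        _ = 1 / 8 := by field_simp
    rw [abs_le] at hin
    set x : ℝ := inner ℝ z ξ with hx
    have hz0 : 0 < ‖z‖ := by
      rw [norm_pos_iff]; rintro rfl
      simp at hx; linarith
    have hsin : 1 / 4 ≤ Real.sin (Real.pi * x) := by
      have := Real.mul_le_sin (x := Real.pi * x) (by have := Real.pi_pos; nlinarith)
        (by have := Real.pi_pos; nlinarith)
      have e : 2 / Real.pi * (Real.pi * x) = 2 * x := by field_simp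
      linarith
    have hnorm : 1 / 2 ≤ ‖(Real.fourierChar (-x) : ℂ) - 1‖ := by
      rw [Real.fourierChar_apply]
      have e : ((2 * Real.pi * -x : ℝ) : ℂ) * Complex.I = Complex.I * ((2 * Real.pi * -x : ℝ) : ℂ) :=
        mul_comm _ _
      rw [e, Complex.norm_exp_I_mul_ofReal_sub_one]
      have e2 : 2 * Real.pi * -x / 2 = -(Real.pi * x) := by ring
      rw [e2, Real.sin_neg, Real.norm_eq_abs, abs_mul, abs_neg]
      have := le_abs_self (Real.sin (Real.pi * x))
      rw [abs_two]; linarith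
    rw [ENNReal.ofReal_mul (by norm_num)]
    refine mul_le_mul' ?_ (ENNReal.ofReal_le_ofReal ?_)
    · rw [← ofReal_norm, ← ENNReal.ofReal_pow (norm_nonneg _)]
      refine ENNReal.ofReal_le_ofReal ?_
      nlinarith
    · gcongr
  calc ENNReal.ofReal (symbol (α / 2) ξ ^ 2)
      = ENNReal.ofReal ((2 * Real.pi) ^ α / c) *
        ENNReal.ofReal ((1 / 4) * ((3 / (8 * ‖ξ‖)) ^ K)⁻¹ * ((1 / (8 * ‖ξ‖)) ^ d * b)) := by
        rw [← ENNReal.ofReal_mul (by positivity)]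
        congr 1
        have e1 : symbol (α / 2) ξ ^ 2 = (2 * Real.pi) ^ α * ‖ξ‖ ^ α := by
          rw [symbol, ← Real.rpow_natCast, ← Real.rpow_mul (by positivity),
            Real.mul_rpow (by positivity) hn.le]
          norm_num
        have e2 : (3 / (8 * ‖ξ‖)) ^ K = (3 / 8) ^ K * (‖ξ‖ ^ d * ‖ξ‖ ^ α)⁻¹ := by
          rw [← Real.rpow_natCast ‖ξ‖ d, ← Real.rpow_add hn, ← hK, ← Real.inv_rpow hn.le,
            ← Real.mul_rpow (by positivity) (by positivity)]
          congr 1; field_simp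
        have e3 : (1 / (8 * ‖ξ‖)) ^ d = (1 / 8) ^ d * (‖ξ‖ ^ d)⁻¹ := by
          rw [← inv_pow, ← mul_pow]; congr 1; field_simp
        rw [e1, e2, e3, hc]
        have : 0 < ‖ξ‖ ^ α := by positivity
        field_simp
    _ = ENNReal.ofReal ((2 * Real.pi) ^ α / c) *
        ∫⁻ z in B, ENNReal.ofReal ((1 / 4) * ((3 / (8 * ‖ξ‖)) ^ K)⁻¹) := by
        rw [setLIntegral_const, hvol, ENNReal.ofReal_mul (by positivity : 0 ≤ 1 / 4 * ((3 / (8 * ‖ξ‖)) ^ K)⁻¹)]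
    _ ≤ _ := by
        refine mul_le_mul_right ?_ _
        exact (setLIntegral_mono' measurableSet_ball hpt).trans (setLIntegral_le_lintegral _ _)

/-- The Gagliardo integral of `G`, with the variables `v` and `z = v - w`, on the Fourier side. -/
theorem lintegral_lintegral_translate_sub {d : ℕ} (K : ℝ) (G : L2 d) :
    ∫⁻ v, ∫⁻ z, ‖G (v - z) - G v‖ₑ ^ 2 * ENNReal.ofReal (‖z‖ ^ K)⁻¹ =
      ∫⁻ ξ, (∫⁻ z : Vel d, ‖(Real.fourierChar (-inner ℝ z ξ) : ℂ) - 1‖ₑ ^ 2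
        * ENNReal.ofReal (‖z‖ ^ K)⁻¹) * ‖(𝓕 G : L2 d) ξ‖ₑ ^ 2 := by
  have hmK : Measurable fun z : Vel d => ENNReal.ofReal (‖z‖ ^ K)⁻¹ :=
    ENNReal.measurable_ofReal.comp (measurable_norm.pow_const _).inv
  have hm1 : Measurable fun p : Vel d × Vel d => ‖G (p.1 - p.2) - G p.1‖ₑ ^ 2 :=
    ((((Lp.stronglyMeasurable G).measurable.comp measurable_sub).sub
      ((Lp.stronglyMeasurable G).measurable.comp measurable_fst)).enorm).pow_const 2
  have hm2 : Measurable fun p : Vel d × Vel d =>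
      ‖(Real.fourierChar (-inner ℝ p.1 p.2) : ℂ) - 1‖ₑ ^ 2 := by
    have : Continuous fun p : Vel d × Vel d => (Real.fourierChar (-inner ℝ p.1 p.2) : ℂ) :=
      continuous_subtype_val.comp (Real.continuous_fourierChar.comp (by fun_prop))
    exact ((this.measurable.sub_const 1).enorm).pow_const 2
  have hm3 : Measurable fun p : Vel d × Vel d =>
      ‖(Real.fourierChar (-inner ℝ p.1 p.2) : ℂ) - 1‖ₑ ^ 2 * ENNReal.ofReal (‖p.1‖ ^ K)⁻¹ :=
    hm2.mul (hmK.comp measurable_fst)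
  have hm4 (ξ : Vel d) : Measurable fun z : Vel d =>
      ‖(Real.fourierChar (-inner ℝ z ξ) : ℂ) - 1‖ₑ ^ 2 * ENNReal.ofReal (‖z‖ ^ K)⁻¹ := by
    have : Continuous fun z : Vel d => (Real.fourierChar (-inner ℝ z ξ) : ℂ) :=
      continuous_subtype_val.comp (Real.continuous_fourierChar.comp (by fun_prop))
    exact (((this.measurable.sub_const 1).enorm).pow_const 2).mul hmK
  have hFm : Measurable fun ξ => ‖(𝓕 G : L2 d) ξ‖ₑ ^ 2 :=
    ((Lp.stronglyMeasurable (𝓕 G : L2 d)).measurable.enorm).pow_const 2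
  have e3 (z : Vel d) : ∫⁻ v, ‖G (v - z) - G v‖ₑ ^ 2 * ENNReal.ofReal (‖z‖ ^ K)⁻¹ =
      ∫⁻ ξ, ‖(Real.fourierChar (-inner ℝ z ξ) : ℂ) - 1‖ₑ ^ 2
        * ENNReal.ofReal (‖z‖ ^ K)⁻¹ * ‖(𝓕 G : L2 d) ξ‖ₑ ^ 2 := by
    rw [lintegral_mul_const' _ _ ENNReal.ofReal_ne_top, lintegral_translate_sub,
      ← lintegral_mul_const' _ _ ENNReal.ofReal_ne_top]
    exact lintegral_congr fun ξ => by ring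
  have hm5 : Measurable fun p : Vel d × Vel d =>
      ‖G (p.1 - p.2) - G p.1‖ₑ ^ 2 * ENNReal.ofReal (‖p.2‖ ^ K)⁻¹ :=
    hm1.mul (hmK.comp measurable_snd)
  have hm6 : Measurable fun p : Vel d × Vel d =>
      ‖(Real.fourierChar (-inner ℝ p.1 p.2) : ℂ) - 1‖ₑ ^ 2 * ENNReal.ofReal (‖p.1‖ ^ K)⁻¹ *
        ‖(𝓕 G : L2 d) p.2‖ₑ ^ 2 :=
    hm3.mul (hFm.comp measurable_snd)
  have s1 := lintegral_lintegral_swap (μ := (volume : Measure (Vel d)))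
    (ν := (volume : Measure (Vel d)))
    (f := fun v z => ‖G (v - z) - G v‖ₑ ^ 2 * ENNReal.ofReal (‖z‖ ^ K)⁻¹) hm5.aemeasurable
  have s2 := lintegral_lintegral_swap (μ := (volume : Measure (Vel d)))
    (ν := (volume : Measure (Vel d)))
    (f := fun z ξ => ‖(Real.fourierChar (-inner ℝ z ξ) : ℂ) - 1‖ₑ ^ 2
      * ENNReal.ofReal (‖z‖ ^ K)⁻¹ * ‖(𝓕 G : L2 d) ξ‖ₑ ^ 2) hm6.aemeasurable
  rw [s1, lintegral_congr e3, s2]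
  exact lintegral_congr fun ξ => lintegral_mul_const _ (hm4 ξ)

/-- The `H^{α/2}` norm is controlled by the `L²` norm and the Gagliardo seminorm. -/
theorem exists_sobolevNormSq_le (d : ℕ) (hd : 1 ≤ d) {α : ℝ} (hα : 0 < α) :
    ∃ C : ℝ, 0 < C ∧ ∀ g : Vel d → ℝ, AEStronglyMeasurable g volume →
      sobolevNormSq (α / 2) g ≤ (∫⁻ v, ENNReal.ofReal (g v ^ 2)) + ENNReal.ofReal C *
        ∫⁻ v, ∫⁻ w, ENNReal.ofReal ((g v - g w) ^ 2 / ‖v - w‖ ^ ((d : ℝ) + α)) := by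
  obtain ⟨C, hC, hsym⟩ := exists_symbol_sq_le d hd hα
  refine ⟨C, hC, fun g hg => ?_⟩
  set A := ∫⁻ v, ENNReal.ofReal (g v ^ 2) with hA
  set D := ∫⁻ v, ∫⁻ w, ENNReal.ofReal ((g v - g w) ^ 2 / ‖v - w‖ ^ ((d : ℝ) + α)) with hD
  by_cases hfin : A + ENNReal.ofReal C * D = ∞
  · rw [hfin]; exact le_top
  have hAfin : A ≠ ∞ := fun h => hfin (by simp [h])
  have hsq (x : ℝ) : ‖((x : ℝ) : ℂ)‖ₑ ^ 2 = ENNReal.ofReal (x ^ 2) := by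
    rw [← ofReal_norm, ← ENNReal.ofReal_pow (norm_nonneg _), Complex.norm_real, Real.norm_eq_abs,
      sq_abs]
  have hmem : MemLp (fun v => (g v : ℂ)) 2 volume := by
    refine ⟨Complex.continuous_ofReal.comp_aestronglyMeasurable hg, ?_⟩
    rw [eLpNorm_lt_top_iff_lintegral_rpow_enorm_lt_top (by norm_num) (by norm_num)]
    have : ∫⁻ v, ‖(g v : ℂ)‖ₑ ^ (2 : ℝ≥0∞).toReal = A := by
      refine lintegral_congr fun v => ?_
      rw [← hsq, ENNReal.toReal_ofNat, ENNReal.rpow_ofNat]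
    rw [this]; exact hAfin.lt_top
  set G : L2 d := hmem.toLp _ with hGdef
  have hG : ∀ᵐ v ∂(volume : Measure (Vel d)), G v = (g v : ℂ) := hmem.coeFn_toLp
  have hGA : ENNReal.ofReal (‖G‖ ^ 2) = A := by
    rw [← lintegral_enorm_sq_eq]
    refine lintegral_congr_ae ?_
    filter_upwards [hG] with v hv
    rw [hv, hsq]
  have hDz : D = ∫⁻ v, ∫⁻ z, ‖G (v - z) - G v‖ₑ ^ 2 *
      ENNReal.ofReal (‖z‖ ^ ((d : ℝ) + α))⁻¹ := by
    refine lintegral_congr_ae ?_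
    filter_upwards [hG] with v hv
    rw [← lintegral_sub_left_eq_self (μ := volume) _ v]
    refine lintegral_congr_ae ?_
    filter_upwards [(quasiMeasurePreserving_sub_left volume v).ae hG] with z hz
    rw [hz, hv, ← Complex.ofReal_sub, hsq, ← ENNReal.ofReal_mul (sq_nonneg _), sub_sub_cancel,
      ← div_eq_mul_inv, ← neg_sub (g v), neg_sq]
  have hDξ : ∫⁻ ξ, ENNReal.ofReal (symbol (α / 2) ξ ^ 2) * ‖(𝓕 G : L2 d) ξ‖ₑ ^ 2
      ≤ ENNReal.ofReal C * D := by
    rw [hDz, lintegral_lintegral_translate_sub, ← lintegral_const_mul' _ _ ENNReal.ofReal_ne_top]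
    refine lintegral_mono fun ξ => ?_
    rw [← mul_assoc]
    exact mul_le_mul_left (hsym ξ) _
  have hUint : ∫⁻ ξ, ‖(symbol (α / 2) ξ : ℂ) * (𝓕 G : L2 d) ξ‖ₑ ^ 2 ≤ ENNReal.ofReal C * D := by
    refine le_trans (le_of_eq (lintegral_congr fun ξ => ?_)) hDξ
    rw [enorm_mul, mul_pow, hsq]
  have hUmem : MemLp (fun ξ => (symbol (α / 2) ξ : ℂ) * (𝓕 G : L2 d) ξ) 2 volume := by
    have hsm : Measurable fun ξ : Vel d => (symbol (α / 2) ξ : ℂ) := by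
      unfold symbol; fun_prop
    refine ⟨(hsm.mul (Lp.stronglyMeasurable (𝓕 G : L2 d)).measurable).aestronglyMeasurable, ?_⟩
    rw [eLpNorm_lt_top_iff_lintegral_rpow_enorm_lt_top (by norm_num) (by norm_num)]
    simp only [ENNReal.toReal_ofNat, ENNReal.rpow_ofNat]
    exact hUint.trans_lt (lt_top_iff_ne_top.2 fun h => hfin (by simp [h]))
  set u : L2 d := 𝓕⁻ (hUmem.toLp _) with hu
  have hFu : (𝓕 u : L2 d) = hUmem.toLp _ := by rw [hu, FourierInvPair.fourier_fourierInv_eq]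
  have hfrac : IsFracLaplacian (α / 2) G u := by
    unfold IsFracLaplacian
    rw [hFu]
    exact hUmem.coeFn_toLp
  have hunorm : ENNReal.ofReal (‖u‖ ^ 2) ≤ ENNReal.ofReal C * D := by
    rw [← Lp.norm_fourier_eq, hFu, ← lintegral_enorm_sq_eq]
    refine le_trans (le_of_eq (lintegral_congr_ae ?_)) hUint
    filter_upwards [hUmem.coeFn_toLp] with ξ hξ
    rw [hξ]
  refine (iInf₂_le_of_le G u (iInf₂_le_of_le hG hfrac le_rfl)).trans ?_
  rw [ENNReal.ofReal_add (sq_nonneg _) (sq_nonneg _), hGA]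
  gcongr

/-! ### The Poincaré inequality and the fractional Sobolev bound -/

section JumpForm

variable {d : ℕ} {K A : ℝ} {ρ h : Vel d → ℝ}

/-- The jump form `∬ (h(v) - h(w))² |v - w|^{-K} ρ(v) dw dv`. -/
def jumpForm (K : ℝ) (ρ h : Vel d → ℝ) : ℝ≥0∞ :=
  ∫⁻ v, ∫⁻ w, ENNReal.ofReal ((h v - h w) ^ 2 / ‖v - w‖ ^ K * ρ v)

theorem measurable_jump_integrand (hρ : Measurable ρ) (hh : Measurable h) :
    Measurable fun p : Vel d × Vel d =>
      ENNReal.ofReal ((h p.1 - h p.2) ^ 2 / ‖p.1 - p.2‖ ^ K * ρ p.1) := by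
  refine ENNReal.measurable_ofReal.comp (Measurable.mul (Measurable.div ?_ ?_) ?_)
  · exact ((hh.comp measurable_fst).sub (hh.comp measurable_snd)).pow_const 2
  · exact (measurable_fst.sub measurable_snd).norm.pow_const K
  · exact hρ.comp measurable_fst

theorem measurable_jump_integrand_left (hρ : Measurable ρ) (hh : Measurable h) (v : Vel d) :
    Measurable fun w => ENNReal.ofReal ((h v - h w) ^ 2 / ‖v - w‖ ^ K * ρ v) :=
  (measurable_jump_integrand hρ hh).of_uncurry_left (f := fun v w : Vel d =>
    ENNReal.ofReal ((h v - h w) ^ 2 / ‖v - w‖ ^ K * ρ v))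

theorem jumpForm_eq_swap (hρ : Measurable ρ) (hh : Measurable h) :
    jumpForm K ρ h = ∫⁻ v, ∫⁻ w, ENNReal.ofReal ((h v - h w) ^ 2 / ‖v - w‖ ^ K * ρ w) := by
  have h1 := lintegral_lintegral_swap (μ := (volume : Measure (Vel d)))
    (ν := (volume : Measure (Vel d)))
    (f := fun v w => ENNReal.ofReal ((h v - h w) ^ 2 / ‖v - w‖ ^ K * ρ v))
    (measurable_jump_integrand hρ hh).aemeasurable
  rw [jumpForm, h1]
  refine lintegral_congr fun v => lintegral_congr fun w => ?_
  rw [norm_sub_rev, ← neg_sub (h v), neg_sq]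

/-- The Poincaré inequality for the jump form. For `h` of mean zero the variance
`∫ (h(v) - h(w))² ρ(w) dw` is at least `h(v)²`, and `ρ ⊗ ρ` is dominated by the jump kernel. -/
theorem HasStableBounds.lintegral_sq_mul_le (hρ : HasStableBounds K A ρ) (hK : 0 < K)
    (hρi : Integrable ρ) (hρ1 : ∫ v, ρ v = 1) (hh : Measurable h)
    (hi1 : Integrable fun v => h v * ρ v) (hi2 : Integrable fun v => h v ^ 2 * ρ v)
    (h0 : ∫ v, h v * ρ v = 0) :
    ∫⁻ v, ENNReal.ofReal (h v ^ 2 * ρ v) ≤ ENNReal.ofReal (2 ^ K * A * 2) * jumpForm K ρ h := by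
  have hρm : Measurable ρ := hρ.continuous.measurable
  have hA := hρ.pos
  have hvar (v : Vel d) : ENNReal.ofReal (h v ^ 2) ≤
      ∫⁻ w, ENNReal.ofReal ((h v - h w) ^ 2 * ρ w) := by
    have e (w : Vel d) : (h v - h w) ^ 2 * ρ w =
        h v ^ 2 * ρ w - 2 * h v * (h w * ρ w) + h w ^ 2 * ρ w := by ring
    have i1 : Integrable fun w => h v ^ 2 * ρ w - 2 * h v * (h w * ρ w) :=
      (hρi.const_mul _).sub (hi1.const_mul _)
    have hint : Integrable fun w => (h v - h w) ^ 2 * ρ w := by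
      simp_rw [e]; exact i1.add hi2
    rw [← ofReal_integral_eq_lintegral_ofReal hint
      (.of_forall fun w => mul_nonneg (sq_nonneg _) (hρ.apply_pos w).le)]
    refine ENNReal.ofReal_le_ofReal ?_
    simp_rw [e]
    rw [integral_add i1 hi2, integral_sub (hρi.const_mul _) (hi1.const_mul _), integral_const_mul,
      integral_const_mul, hρ1, h0]
    have : 0 ≤ ∫ w, h w ^ 2 * ρ w :=
      integral_nonneg fun w => mul_nonneg (sq_nonneg _) (hρ.apply_pos w).le
    linarith
  have hpt (v w : Vel d) : ENNReal.ofReal ((h v - h w) ^ 2 * ρ w) * ENNReal.ofReal (ρ v) ≤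
      ENNReal.ofReal (2 ^ K * A) *
        (ENNReal.ofReal ((h v - h w) ^ 2 / ‖v - w‖ ^ K * ρ v) +
          ENNReal.ofReal ((h v - h w) ^ 2 / ‖v - w‖ ^ K * ρ w)) := by
    have pv := hρ.apply_pos v
    have pw := hρ.apply_pos w
    rw [← ENNReal.ofReal_add (by positivity) (by positivity), ← ENNReal.ofReal_mul (by positivity),
      ← ENNReal.ofReal_mul (by positivity)]
    refine ENNReal.ofReal_le_ofReal ?_
    rcases eq_or_ne v w with rfl | hne
    · simp
    have hz : 0 < ‖v - w‖ := norm_pos_iff.2 (sub_ne_zero.2 hne)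
    have h1 := hρ.mul_mul_rpow_le hK v w
    have h2 : ρ v * ρ w ≤ 2 ^ K * A * (ρ v + ρ w) / ‖v - w‖ ^ K := by
      rwa [le_div_iff₀ (by positivity)]
    calc (h v - h w) ^ 2 * ρ w * ρ v = (h v - h w) ^ 2 * (ρ v * ρ w) := by ring
      _ ≤ (h v - h w) ^ 2 * (2 ^ K * A * (ρ v + ρ w) / ‖v - w‖ ^ K) := by gcongr
      _ = _ := by ring
  have hinner (v : Vel d) : ENNReal.ofReal (h v ^ 2 * ρ v) ≤ ENNReal.ofReal (2 ^ K * A) *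
      ((∫⁻ w, ENNReal.ofReal ((h v - h w) ^ 2 / ‖v - w‖ ^ K * ρ v)) +
        ∫⁻ w, ENNReal.ofReal ((h v - h w) ^ 2 / ‖v - w‖ ^ K * ρ w)) := by
    rw [ENNReal.ofReal_mul (sq_nonneg _),
      ← lintegral_add_left (measurable_jump_integrand_left hρm hh v),
      ← lintegral_const_mul' _ _ ENNReal.ofReal_ne_top]
    refine (mul_le_mul_left (hvar v) _).trans ?_
    rw [← lintegral_mul_const' _ _ ENNReal.ofReal_ne_top]
    exact lintegral_mono fun w => hpt v w
  refine (lintegral_mono hinner).trans ?_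
  have hm1 : Measurable fun v => ∫⁻ w, ENNReal.ofReal ((h v - h w) ^ 2 / ‖v - w‖ ^ K * ρ v) :=
    (measurable_jump_integrand hρm hh).lintegral_prod_right'
  rw [lintegral_const_mul' _ _ ENNReal.ofReal_ne_top, lintegral_add_left hm1,
    ← jumpForm_eq_swap hρm hh, ← jumpForm, ← two_mul, ← mul_assoc,
    ENNReal.ofReal_mul (by positivity : 0 ≤ 2 ^ K * A)]
  simp

/-- The Gagliardo seminorm of `h √ρ` is controlled by the jump form and the norm of `h`
in `L²(ρ)`. -/
theorem HasStableBounds.exists_gagliardo_le (hρ : HasStableBounds K A ρ) (hd : 1 ≤ d)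
    (hK : (d : ℝ) < K) (hK2 : K < d + 2) (hρi : Integrable ρ) :
    ∃ C : ℝ, 0 ≤ C ∧ ∀ h : Vel d → ℝ, Measurable h →
      ∫⁻ v, ∫⁻ w, ENNReal.ofReal ((h v * √(ρ v) - h w * √(ρ w)) ^ 2 / ‖v - w‖ ^ K) ≤
        2 * jumpForm K ρ h + ENNReal.ofReal C * ∫⁻ v, ENNReal.ofReal (h v ^ 2 * ρ v) := by
  have hρm : Measurable ρ := hρ.continuous.measurable
  have hK0 : 0 < K := d.cast_nonneg.trans_lt hK
  have hA := hρ.pos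
  set B : ℝ := 1 + A + A ^ 2 + 2 ^ K * A + 2 ^ K * A ^ 2 with hB
  have hB0 : 0 < B := by positivity
  have hki := integrable_truncatedKernel hd hK hK2
  set J : ℝ := ∫ z : Vel d, truncatedKernel K z with hJ
  have hJ0 : 0 ≤ J := integral_nonneg fun z => truncatedKernel_nonneg K z
  have hR0 : 0 ≤ ∫ v, ρ v := integral_nonneg fun v => (hρ.apply_pos v).le
  refine ⟨2 * B * (J + ∫ v, ρ v), by positivity, fun h hh => ?_⟩
  have hpt (v w : Vel d) :
      ENNReal.ofReal ((h v * √(ρ v) - h w * √(ρ w)) ^ 2 / ‖v - w‖ ^ K) ≤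
      2 * ENNReal.ofReal ((h v - h w) ^ 2 / ‖v - w‖ ^ K * ρ v) +
        ENNReal.ofReal (2 * B) * (ENNReal.ofReal (h w ^ 2 * ρ w) *
          ENNReal.ofReal (truncatedKernel K (v - w) + ρ v)) := by
    have pv := hρ.apply_pos v
    have pw := hρ.apply_pos w
    have hk0 := truncatedKernel_nonneg K (v - w)
    have e2 (x : ℝ) : 2 * ENNReal.ofReal x = ENNReal.ofReal (2 * x) := by
      rw [ENNReal.ofReal_mul (by norm_num), ENNReal.ofReal_ofNat]
    rw [← ENNReal.ofReal_mul (by positivity), ← ENNReal.ofReal_mul (by positivity), e2,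
      ← ENNReal.ofReal_add (by positivity) (by positivity)]
    refine ENNReal.ofReal_le_ofReal ?_
    have ev := Real.sq_sqrt pv.le
    have h1 : (h v * √(ρ v) - h w * √(ρ w)) ^ 2 ≤
        2 * ((h v - h w) ^ 2 * ρ v) + 2 * (h w ^ 2 * (√(ρ v) - √(ρ w)) ^ 2) := by
      have e : 2 * ((h v - h w) ^ 2 * ρ v) + 2 * (h w ^ 2 * (√(ρ v) - √(ρ w)) ^ 2) -
          (h v * √(ρ v) - h w * √(ρ w)) ^ 2 =
          ((h v - h w) * √(ρ v) - h w * (√(ρ v) - √(ρ w))) ^ 2 := by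
        rw [← ev]
        rw [Real.sqrt_sq (Real.sqrt_nonneg _)]
        ring
      have := sq_nonneg ((h v - h w) * √(ρ v) - h w * (√(ρ v) - √(ρ w)))
      linarith
    have h2 := hρ.sq_sqrt_sub_sqrt_div_le hK0 v w
    calc (h v * √(ρ v) - h w * √(ρ w)) ^ 2 / ‖v - w‖ ^ K
        ≤ (2 * ((h v - h w) ^ 2 * ρ v) + 2 * (h w ^ 2 * (√(ρ v) - √(ρ w)) ^ 2)) / ‖v - w‖ ^ K := by
          gcongr
      _ = 2 * ((h v - h w) ^ 2 / ‖v - w‖ ^ K * ρ v) +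
          2 * h w ^ 2 * ((√(ρ v) - √(ρ w)) ^ 2 / ‖v - w‖ ^ K) := by ring
      _ ≤ 2 * ((h v - h w) ^ 2 / ‖v - w‖ ^ K * ρ v) +
          2 * h w ^ 2 * (B * ρ w * (truncatedKernel K (v - w) + ρ v)) := by gcongr
      _ = _ := by ring
  have hm1 : Measurable fun v => ∫⁻ w, ENNReal.ofReal ((h v - h w) ^ 2 / ‖v - w‖ ^ K * ρ v) :=
    (measurable_jump_integrand hρm hh).lintegral_prod_right'
  have hinner (v : Vel d) :
      ∫⁻ w, ENNReal.ofReal ((h v * √(ρ v) - h w * √(ρ w)) ^ 2 / ‖v - w‖ ^ K) ≤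
      2 * (∫⁻ w, ENNReal.ofReal ((h v - h w) ^ 2 / ‖v - w‖ ^ K * ρ v)) +
        ENNReal.ofReal (2 * B) * ∫⁻ w, ENNReal.ofReal (h w ^ 2 * ρ w) *
          ENNReal.ofReal (truncatedKernel K (v - w) + ρ v) := by
    refine (lintegral_mono (hpt v)).trans (le_of_eq ?_)
    rw [lintegral_add_left ((measurable_jump_integrand_left hρm hh v).const_mul 2),
      lintegral_const_mul' _ _ ENNReal.ofNat_ne_top, lintegral_const_mul' _ _ ENNReal.ofReal_ne_top]
  refine (lintegral_mono hinner).trans ?_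
  rw [lintegral_add_left (hm1.const_mul 2), lintegral_const_mul' _ _ ENNReal.ofNat_ne_top,
    lintegral_const_mul' _ _ ENNReal.ofReal_ne_top, ← jumpForm]
  refine add_le_add le_rfl (le_of_eq ?_)
  have hm2 : Measurable fun p : Vel d × Vel d => ENNReal.ofReal (h p.2 ^ 2 * ρ p.2) *
      ENNReal.ofReal (truncatedKernel K (p.1 - p.2) + ρ p.1) := by
    have m1 : Measurable fun p : Vel d × Vel d => ENNReal.ofReal (h p.2 ^ 2 * ρ p.2) :=
      ENNReal.measurable_ofReal.comp
        (((hh.comp measurable_snd).pow_const 2).mul (hρm.comp measurable_snd))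
    have m2 : Measurable fun p : Vel d × Vel d =>
        ENNReal.ofReal (truncatedKernel K (p.1 - p.2) + ρ p.1) :=
      ENNReal.measurable_ofReal.comp (((measurable_truncatedKernel K).comp
        (measurable_fst.sub measurable_snd)).add (hρm.comp measurable_fst))
    exact m1.mul m2
  have hswap := lintegral_lintegral_swap (μ := (volume : Measure (Vel d)))
    (ν := (volume : Measure (Vel d))) (f := fun v w => ENNReal.ofReal (h w ^ 2 * ρ w) *
      ENNReal.ofReal (truncatedKernel K (v - w) + ρ v)) hm2.aemeasurable
  have hconst (w : Vel d) : ∫⁻ v, ENNReal.ofReal (truncatedKernel K (v - w) + ρ v) =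
      ENNReal.ofReal (J + ∫ v, ρ v) := by
    have i1 : Integrable fun v => truncatedKernel K (v - w) + ρ v :=
      (hki.comp_sub_right w).add hρi
    rw [← ofReal_integral_eq_lintegral_ofReal i1
      (.of_forall fun v => add_nonneg (truncatedKernel_nonneg _ _) (hρ.apply_pos v).le),
      integral_add (hki.comp_sub_right w) hρi, integral_sub_right_eq_self (truncatedKernel K) w]
  rw [hswap, ENNReal.ofReal_mul (by positivity : 0 ≤ 2 * B), mul_assoc]
  congr 1
  rw [← lintegral_const_mul' _ _ ENNReal.ofReal_ne_top]
  refine lintegral_congr fun w => ?_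
  rw [lintegral_const_mul' _ _ ENNReal.ofReal_ne_top, hconst, mul_comm]

/-- The Poincaré and Gagliardo bounds together. -/
theorem HasStableBounds.exists_sobolevNormSq_mul_sqrt_le {α : ℝ} (hα₀ : 0 < α) (hα₂ : α < 2)
    (hρ : HasStableBounds ((d : ℝ) + α) A ρ) (hd : 1 ≤ d) (hρ1 : ∫ v, ρ v = 1) :
    ∃ C : ℝ, 0 < C ∧ ∀ h : Vel d → ℝ, Measurable h → Integrable (fun v => h v * ρ v) →
      Integrable (fun v => h v ^ 2 * ρ v) → ∫ v, h v * ρ v = 0 →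
      sobolevNormSq (α / 2) (fun v => h v * √(ρ v)) ≤
        ENNReal.ofReal C * jumpForm ((d : ℝ) + α) ρ h := by
  have hA := hρ.pos
  have hK0 : 0 < (d : ℝ) + α := by positivity
  have hρi := hρ.integrable (by linarith)
  have hρm : Measurable ρ := hρ.continuous.measurable
  obtain ⟨C₁, hC₁, hsob⟩ := exists_sobolevNormSq_le d hd hα₀
  obtain ⟨C₂, hC₂, hgag⟩ := hρ.exists_gagliardo_le hd (by linarith) (by linarith) hρi
  set P : ℝ := 2 ^ ((d : ℝ) + α) * A * 2 with hP
  have hP0 : 0 < P := by positivity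
  refine ⟨P + C₁ * (2 + C₂ * P), by positivity, fun h hh hi1 hi2 h0 => ?_⟩
  have hpoin := hρ.lintegral_sq_mul_le hK0 hρi hρ1 hh hi1 hi2 h0
  set D := jumpForm ((d : ℝ) + α) ρ h with hD
  refine (hsob (fun v => h v * √(ρ v)) (hh.mul hρm.sqrt).aestronglyMeasurable).trans ?_
  have e1 : ∫⁻ v, ENNReal.ofReal ((h v * √(ρ v)) ^ 2) = ∫⁻ v, ENNReal.ofReal (h v ^ 2 * ρ v) :=
    lintegral_congr fun v => by rw [mul_pow, Real.sq_sqrt (hρ.apply_pos v).le]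
  rw [e1]
  calc _ ≤ ENNReal.ofReal P * D + ENNReal.ofReal C₁ *
        (2 * D + ENNReal.ofReal C₂ * (ENNReal.ofReal P * D)) := by
        gcongr
        exact (hgag h hh).trans (by gcongr)
    _ = ENNReal.ofReal (P + C₁ * (2 + C₂ * P)) * D := by
        rw [ENNReal.ofReal_add hP0.le (by positivity), ENNReal.ofReal_mul hC₁.le,
          ENNReal.ofReal_add (by norm_num) (by positivity), ENNReal.ofReal_mul hC₂]
        have e2 : ENNReal.ofReal 2 = 2 := by simp
        rw [e2]
        ring

end JumpForm

/-! ### The equilibrium -/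

theorem exists_hasStableBounds_equilibrium {d : ℕ} (hd : 1 ≤ d) {α : ℝ} (hα₀ : 0 < α)
    (hα₂ : α < 2) : (∃ A : ℝ, HasStableBounds ((d : ℝ) + α) A (equilibrium d α)) ∧
      ∫ v, equilibrium d α v = 1 := by
  obtain ⟨A, hP⟩ := exists_hasStableBounds_stableProfile hd hα₀ hα₂
  have hi := hP.integrable (by linarith)
  have hZ : 0 < ∫ w, stableProfile d α w := by
    rw [integral_pos_iff_support_of_nonneg (fun v => (hP.apply_pos v).le) hi]
    have : Function.support (stableProfile d α) = Set.univ :=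
      Set.eq_univ_of_forall fun v => (hP.apply_pos v).ne'
    rw [this]
    exact Measure.measure_univ_pos.2 (NeZero.ne _)
  refine ⟨⟨_, hP.const_mul (inv_pos.2 hZ)⟩, ?_⟩
  simp only [equilibrium]
  rw [integral_const_mul, inv_mul_cancel₀ hZ.ne']

theorem fracConst_pos (d : ℕ) {α : ℝ} (hα₀ : 0 < α) (hα₂ : α < 2) : 0 < fracConst d α := by
  have h1 : 0 < Real.Gamma (((d : ℝ) + α) / 2) := Real.Gamma_pos_of_pos (by positivity)
  have h2 : Real.Gamma (-α / 2) ≠ 0 := by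
    refine Real.Gamma_ne_zero fun m hm => ?_
    have h3 : (m : ℝ) = α / 2 := by linarith
    have h4 : (m : ℝ) < 1 := by linarith
    have h5 : m < 1 := by exact_mod_cast h4
    have h6 : m = 0 := by omega
    rw [h6] at h3
    norm_num at h3
    linarith
  have h3 : 0 < |Real.Gamma (-α / 2)| := abs_pos.2 h2
  unfold fracConst
  have := Real.pi_pos
  positivity

theorem sobolevNormSq_congr {d : ℕ} (s : ℝ) {g g' : Vel d → ℝ}
    (h : ∀ᵐ v ∂(volume : Measure (Vel d)), g v = g' v) : sobolevNormSq s g = sobolevNormSq s g' := by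
  have e (G : L2 d) : (∀ᵐ v ∂(volume : Measure (Vel d)), G v = (g v : ℂ)) ↔
      ∀ᵐ v ∂(volume : Measure (Vel d)), G v = (g' v : ℂ) := by
    constructor <;> intro hG <;> filter_upwards [h, hG] with v h1 h2 <;> simp [h2, h1]
  simp only [sobolevNormSq, e]

end LevyFP

end

theorem mainTheorem3 (d : ℕ) (hd : 1 ≤ d) (α : ℝ) (hα₀ : 0 < α) (hα₂ : α < 2) :
    ∃ C : ℝ, 0 < C ∧ ∀ f : LevyFP.Vel d → ℝ, LevyFP.MemDomain α f →
      LevyFP.sobolevNormSq (α / 2)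
          (fun v => (f v - LevyFP.proj α f v) * (LevyFP.equilibrium d α v) ^ (-(1 / 2) : ℝ))
        ≤ ENNReal.ofReal C * LevyFP.dissipation α f := by
  obtain ⟨⟨A, hρ⟩, hρ1⟩ := LevyFP.exists_hasStableBounds_equilibrium hd hα₀ hα₂
  obtain ⟨C, hC, hmain⟩ := hρ.exists_sobolevNormSq_mul_sqrt_le hα₀ hα₂ hd hρ1
  have hc := LevyFP.fracConst_pos d hα₀ hα₂
  have hρi := hρ.integrable (by linarith)
  have hρm : Measurable (LevyFP.equilibrium d α) := hρ.continuous.measurable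
  set c := LevyFP.fracConst d α with hcdef
  refine ⟨C * (c / 2)⁻¹, by positivity, fun f hf => ?_⟩
  obtain ⟨⟨hfm, hf2⟩, -⟩ := hf
  set ρ := LevyFP.equilibrium d α with hρdef
  have hpos := hρ.apply_pos
  -- `f` is integrable because `|f| ≤ f² / ρ + ρ`
  have hfi : Integrable f := by
    refine (hf2.add hρi).mono' hfm (.of_forall fun v => ?_)
    have hv := hpos v
    rw [Pi.add_apply, Real.norm_eq_abs, ← div_eq_mul_inv, ← sub_le_iff_le_add,
      le_div_iff₀ hv, ← sq_abs]
    nlinarith [sq_nonneg (|f v| - ρ v), abs_nonneg (f v), mul_nonneg (abs_nonneg (f v)) hv.le]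
  set m := ∫ w, f w with hm
  set f' := hfm.mk f with hf'
  have hff' : ∀ᵐ v, f v = f' v := hfm.ae_eq_mk
  set h : LevyFP.Vel d → ℝ := fun v => f' v * (ρ v)⁻¹ - m with hh
  have hhm : Measurable h := (hfm.stronglyMeasurable_mk.measurable.mul hρm.inv).sub_const m
  have hhρ : ∀ᵐ v, f v - m * ρ v = h v * ρ v := by
    filter_upwards [hff'] with v hv
    have := (hpos v).ne'
    rw [hv, hh]
    field_simp
  have hi1 : Integrable fun v => h v * ρ v := (hfi.sub (hρi.const_mul m)).congr hhρ
  have hi2 : Integrable fun v => h v ^ 2 * ρ v := by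
    refine ((hf2.sub (hfi.const_mul (2 * m))).add (hρi.const_mul (m ^ 2))).congr ?_
    filter_upwards [hff'] with v hv
    have := (hpos v).ne'
    simp only [Pi.add_apply, Pi.sub_apply]
    rw [hv, hh]
    field_simp
    ring
  have h0 : ∫ v, h v * ρ v = 0 := by
    rw [← integral_congr_ae hhρ, integral_sub hfi (hρi.const_mul m), integral_const_mul, hρ1]
    simp [hm]
  have hD : LevyFP.dissipation α f =
      ENNReal.ofReal (c / 2) * LevyFP.jumpForm ((d : ℝ) + α) ρ h := by
    rw [LevyFP.dissipation, LevyFP.jumpForm]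
    congr 1
    refine lintegral_congr_ae ?_
    filter_upwards [hff'] with v hv
    refine lintegral_congr_ae ?_
    filter_upwards [hff'] with w hw
    simp only [hh]
    rw [hv, hw, sub_sub_sub_cancel_right]
  have hg : ∀ᵐ v, (f v - LevyFP.proj α f v) * (ρ v) ^ (-(1 / 2) : ℝ) = h v * √(ρ v) := by
    filter_upwards [hhρ] with v hv
    have e : LevyFP.proj α f v = m * ρ v := rfl
    have h1 := Real.sqrt_pos.2 (hpos v)
    rw [e, hv, Real.rpow_neg (hpos v).le, ← Real.sqrt_eq_rpow, mul_assoc]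
    congr 1
    rw [← div_eq_mul_inv, Real.div_sqrt]
  rw [LevyFP.sobolevNormSq_congr _ hg, hD, ← mul_assoc, ← ENNReal.ofReal_mul (by positivity)]
  have e : C * (c / 2)⁻¹ * (c / 2) = C := by field_simp
  rw [e]
  exact hmain h hhm hi1 hi2 h0
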